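/- Corollary 2.6 (Improved $L^2$-uncertainty type inequality). Let $M$ be a complete noncompact Riemannian manifold of dimension $n>1$ with Riemannian volume $dx$, let $\Omega\subset M$ be a bounded open set, and let $1<q<2$ and $\alpha\in\mathbb{R}$. Then there is a constant $C_1>0$, depending only on $M,\Omega,q,\alpha$, with the following property. Let $C>0$ satisfy $C+\alpha-1>0$, and let $\rho\ge 0$ be a locally Lipschitz function on $M$ with $|\nabla\rho|=1$ almost everywhere and $\Delta\rho\ge \frac{C}{\rho}$ in the sense of distributions on $M\setminus\rho^{-1}\{0\}$, that is, $$-\int_M\langle\nabla\rho,\nabla\psi\rangle\,dx\ \ge\ \int_M \frac{C}{\rho}\,\psi\,dx\qquad\text{for all } 0\le\psi\in C_c^\infty(M\setminus\rho^{-1}\{0\}).$$ Then for every $\phi\in C_c^\infty(\Omega)$ one has $$C_1\Big(\int_M|\nabla\phi|^q\rho^{\frac{\alpha q}{2}}dx\Big)^{2/q}\le \int_M\rho^{\alpha}|\nabla\phi|^2dx<\infty$$ (so that the difference below is well defined and nonnegative), and $$\Big(\int_M \rho^{2-\alpha}\phi^2dx\Big)\Big(\int_M\rho^{\alpha}|\nabla\phi|^2dx-C_1\Big(\int_M|\nabla\phi|^q\rho^{\frac{\alpha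 q}{2}}dx\Big)^{2/q}\Big)\ \ge\ \Big(\frac{C+\alpha-1}{2}\Big)^2\Big(\int_M\phi^2dx\Big)^2 ,$$ where the first factor on the left is allowed to be $+\infty$ (with $(+\infty)\cdot 0=0$). -/

import Mathlib

open Bundle MeasureTheory Set
open scoped Manifold ContDiff ENNReal

namespace RiemHardy

noncomputable section

/-- The Riemannian gradient of `f` at `x`: the tangent vector representing the differential `d f_x`
through the inner product of the tangent space. (It is `0` where `f` is not differentiable.) -/
def grad {n : ℕ} {M : Type*} [TopologicalSpace M] [ChartedSpace (EuclideanSpace ℝ (Fin n)) M]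
    [RiemannianBundle (fun x : M => TangentSpace (𝓡 n) x)]
    (f : M → ℝ) (x : M) : TangentSpace (𝓡 n) x :=
  haveI : FiniteDimensional ℝ (TangentSpace (𝓡 n) x) :=
    inferInstanceAs (FiniteDimensional ℝ (EuclideanSpace ℝ (Fin n)))
  haveI : CompleteSpace (TangentSpace (𝓡 n) x) := FiniteDimensional.complete ℝ _
  (InnerProductSpace.toDual ℝ (TangentSpace (𝓡 n) x)).symm (mfderiv (𝓡 n) 𝓘(ℝ, ℝ) f x)

/-- The `i`-th coordinate vector field `∂ᵢ` of the chart at `p`, at the point of `M` whose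
coordinates are `u`. -/
def coordField {n : ℕ} {M : Type*} [TopologicalSpace M]
    [ChartedSpace (EuclideanSpace ℝ (Fin n)) M] (p : M) (u : EuclideanSpace ℝ (Fin n))
    (i : Fin n) : TangentSpace (𝓡 n) ((chartAt (EuclideanSpace ℝ (Fin n)) p).symm u) :=
  mfderiv (𝓡 n) (𝓡 n) (chartAt (EuclideanSpace ℝ (Fin n)) p).symm u
    (EuclideanSpace.single i (1 : ℝ) : EuclideanSpace ℝ (Fin n))

/-- The volume density `√(det (gᵢⱼ))`, with `gᵢⱼ = ⟨∂ᵢ, ∂ⱼ⟩`, in the chart at `p`. -/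
def volDensity {n : ℕ} {M : Type*} [TopologicalSpace M]
    [ChartedSpace (EuclideanSpace ℝ (Fin n)) M]
    [RiemannianBundle (fun x : M => TangentSpace (𝓡 n) x)]
    (p : M) (u : EuclideanSpace ℝ (Fin n)) : ℝ :=
  Real.sqrt (Matrix.of fun i j : Fin n => inner ℝ (coordField p u i) (coordField p u j)).det

/-- The measure `√(det (gᵢⱼ)) du` of the chart at `p`, carried to `M` (it lives on the domain of
the chart). -/
def chartVolume {n : ℕ} {M : Type*} [TopologicalSpace M] [MeasurableSpace M]
    [ChartedSpace (EuclideanSpace ℝ (Fin n)) M]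
    [RiemannianBundle (fun x : M => TangentSpace (𝓡 n) x)] (p : M) : Measure M :=
  (((volume : Measure (EuclideanSpace ℝ (Fin n))).restrict
      (chartAt (EuclideanSpace ℝ (Fin n)) p).target).withDensity
        (fun u => ENNReal.ofReal (volDensity p u))).map
    (chartAt (EuclideanSpace ℝ (Fin n)) p).symm

variable (n : ℕ) (M : Type*) in
/-- The Riemannian volume measure. The measures `√(det (gᵢⱼ)) du` of two charts agree where the
domains of the charts overlap; the volume is the measure that they define together, namely the
least measure that dominates all of them. -/
def riemVolume [TopologicalSpace M] [MeasurableSpace M]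
    [ChartedSpace (EuclideanSpace ℝ (Fin n)) M]
    [RiemannianBundle (fun x : M => TangentSpace (𝓡 n) x)] : Measure M :=
  ⨆ p : M, chartVolume (n := n) p

/-- `Δ ρ ≥ C / ρ` in the sense of distributions on the open set `{ρ ≠ 0}`, for a locally Lipschitz
function `ρ`: the distribution `Δ ρ` is `ψ ↦ - ∫ ⟨∇ρ, ∇ψ⟩`, and it is compared with `C / ρ` on
nonnegative test functions. -/
def DistribLaplacianGe (n : ℕ) {M : Type*} [TopologicalSpace M] [MeasurableSpace M]
    [ChartedSpace (EuclideanSpace ℝ (Fin n)) M]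
    [RiemannianBundle (fun x : M => TangentSpace (𝓡 n) x)] (ρ : M → ℝ) (C : ℝ) : Prop :=
  ∀ ψ : M → ℝ, ContMDiff (𝓡 n) 𝓘(ℝ, ℝ) ∞ ψ → HasCompactSupport ψ →
    tsupport ψ ⊆ {x | ρ x ≠ 0} → (∀ x, 0 ≤ ψ x) →
    ∫ x, C / ρ x * ψ x ∂(riemVolume n M) ≤
      - ∫ x, inner ℝ (grad (n := n) ρ x) (grad (n := n) ψ x) ∂(riemVolume n M)

/-- The integral `∫_M f` of a nonnegative function `f`, as an element of `[0, ∞]`. -/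
def integralM (n : ℕ) {M : Type*} [TopologicalSpace M] [MeasurableSpace M]
    [ChartedSpace (EuclideanSpace ℝ (Fin n)) M]
    [RiemannianBundle (fun x : M => TangentSpace (𝓡 n) x)] (f : M → ℝ) : ℝ≥0∞ :=
  ∫⁻ x, ENNReal.ofReal (f x) ∂(riemVolume n M)

end

end RiemHardy

open RiemHardy

/-! Put `b = (C + α - 1) / 2` and let W = ρ^(α/2 - b) ∇(ρ^b φ) = ρ^(α/2) ∇φ + b ρ^(α/2 - 1) φ ∇ρ.
Formally, |∇ρ| = 1 and Δρ ≥ C/ρ give div(ρ^(γ+1) ∇ρ) ≥ (C + γ + 1) ρ^γ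
(`HardyWeight.integral_rpow_mul_le`). Expand |W|² and test this with γ = α - 2 against φ²; since C +
γ + 1 = 2b, the cross term yields the Hardy inequality with remainder ∫|W|² + b² ∫ρ^(α-2) φ² ≤ ∫ρ^α
|∇φ|² (`HardyWeight.integral_norm_twistedGrad_sq_le`).

The remainder controls the L^q norm of ρ^(α/2) |∇φ|. Put s = ρ^(α/2 - 1) |φ|. Testing against |φ|^q
gives (C + 1)(1 - q/2) ∫s^q ≤ q ∫s^(q-1) |W|, whose constant is positive because q < 2; Hölder then
bounds ‖s‖_q by ‖W‖_q. The triangle inequality and Hölder on Ω, of finite volume by Hopf–Rinow,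
bound ‖ρ^(α/2) ∇φ‖_q by ‖W‖_2 (`sq_eLpNorm'_le`). The factor b / (C + 1) is bounded in terms of α
alone, so the constant depends neither on C nor on ρ (`HardyWeight.improved_hardy`). Cauchy–Schwarz,
(∫φ²)² ≤ ∫ρ^(2-α) φ² · ∫ρ^(α-2) φ², turns the improved Hardy inequality into the uncertainty
inequality.

To make the divergence inequality rigorous, the distributional hypothesis is extended from smooth to
Lipschitz test functions by mollifying in charts and summing over a partition of unity
(`HardyWeight.lipschitz_test`). It is then applied to smooth cutoffs of ρ^(γ+1) near the zero set,
and the cutoff is removed once ρ^β is known to be locally integrable for β > -C - 1. -/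

namespace RiemHardy

open Filter Topology
open scoped NNReal Convolution

/-! ### The metric and the gradient in coordinates. -/

section Gram

variable {n : ℕ} {M : Type*} [TopologicalSpace M]
    [ChartedSpace (EuclideanSpace ℝ (Fin n)) M]

/-- The Gram matrix `gᵢⱼ = ⟨∂ᵢ, ∂ⱼ⟩` of the coordinate fields of the chart at `p`. -/
noncomputable def gram [RiemannianBundle (fun x : M => TangentSpace (𝓡 n) x)]
    (p : M) (u : EuclideanSpace ℝ (Fin n)) : Matrix (Fin n) (Fin n) ℝ :=
  Matrix.of fun i j : Fin n => inner ℝ (coordField p u i) (coordField p u j)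

/-- The differential of the inverse of the chart at `p`. -/
noncomputable def coordMap (p : M) (u : EuclideanSpace ℝ (Fin n)) :
    EuclideanSpace ℝ (Fin n) →L[ℝ]
      TangentSpace (𝓡 n) ((chartAt (EuclideanSpace ℝ (Fin n)) p).symm u) :=
  mfderiv (𝓡 n) (𝓡 n) (chartAt (EuclideanSpace ℝ (Fin n)) p).symm u

theorem coordMap_eq_sum (p : M) (u a : EuclideanSpace ℝ (Fin n)) :
    coordMap p u a = ∑ i, a i • coordField p u i := by
  conv_lhs => rw [← (EuclideanSpace.basisFun (Fin n) ℝ).sum_repr a]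
  rw [map_sum]
  refine Finset.sum_congr rfl fun i _ => ?_
  rw [map_smul]
  simp only [EuclideanSpace.basisFun_repr, EuclideanSpace.basisFun_apply]
  rfl

theorem inner_coordMap [RiemannianBundle (fun x : M => TangentSpace (𝓡 n) x)]
    (p : M) (u a b : EuclideanSpace ℝ (Fin n)) :
    inner ℝ (coordMap p u a) (coordMap p u b) = a.ofLp ⬝ᵥ (gram p u).mulVec b.ofLp := by
  simp only [coordMap_eq_sum, sum_inner, inner_sum, inner_smul_left, inner_smul_right, dotProduct,
    Matrix.mulVec, gram, Matrix.of_apply, Finset.mul_sum]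
  rw [Finset.sum_comm]
  refine Finset.sum_congr rfl fun i _ => Finset.sum_congr rfl fun j _ => ?_
  simp only [conj_trivial]
  ring

theorem volDensity_eq [RiemannianBundle (fun x : M => TangentSpace (𝓡 n) x)]
    (p : M) (u : EuclideanSpace ℝ (Fin n)) :
    volDensity p u = Real.sqrt (gram p u).det := rfl

theorem inner_grad [RiemannianBundle (fun x : M => TangentSpace (𝓡 n) x)]
    (f : M → ℝ) (x : M) (v : TangentSpace (𝓡 n) x) :
    inner ℝ (grad (n := n) f x) v = mfderiv (𝓡 n) 𝓘(ℝ, ℝ) f x v := by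
  have : FiniteDimensional ℝ (TangentSpace (𝓡 n) x) :=
    inferInstanceAs (FiniteDimensional ℝ (EuclideanSpace ℝ (Fin n)))
  have : CompleteSpace (TangentSpace (𝓡 n) x) := FiniteDimensional.complete ℝ _
  exact InnerProductSpace.toDual_symm_apply

variable [IsManifold (𝓡 n) ∞ M]

theorem mdifferentiableAt_chart_symm {p : M} {u : EuclideanSpace ℝ (Fin n)}
    (hu : u ∈ (chartAt (EuclideanSpace ℝ (Fin n)) p).target) :
    MDifferentiableAt (𝓡 n) (𝓡 n) (chartAt (EuclideanSpace ℝ (Fin n)) p).symm u :=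
  haveI : IsManifold (𝓡 n) 1 M := IsManifold.of_le (n := ∞) (by norm_cast)
  (mdifferentiable_chart p).mdifferentiableAt_symm hu

theorem mdifferentiableAt_chart {p x : M}
    (hx : x ∈ (chartAt (EuclideanSpace ℝ (Fin n)) p).source) :
    MDifferentiableAt (𝓡 n) (𝓡 n) (chartAt (EuclideanSpace ℝ (Fin n)) p) x :=
  haveI : IsManifold (𝓡 n) 1 M := IsManifold.of_le (n := ∞) (by norm_cast)
  (mdifferentiable_chart p).mdifferentiableAt hx

theorem coordMap_bijective {p : M} {u : EuclideanSpace ℝ (Fin n)}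
    (hu : u ∈ (chartAt (EuclideanSpace ℝ (Fin n)) p).target) :
    Function.Bijective (coordMap p u) :=
  haveI : IsManifold (𝓡 n) 1 M := IsManifold.of_le (n := ∞) (by norm_cast)
  (mdifferentiable_chart (I := 𝓡 n) p).symm.mfderiv_bijective hu

theorem contMDiffOn_coordField (p : M) (i : Fin n) :
    ContMDiffOn (𝓡 n) (𝓡 n).tangent ∞
      (fun u => (⟨_, coordField p u i⟩ : TangentBundle (𝓡 n) M))
      (chartAt (EuclideanSpace ℝ (Fin n)) p).target := by
  have h1 : ContMDiffOn (𝓡 n) (𝓡 n) ∞ (chartAt (EuclideanSpace ℝ (Fin n)) p).symm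
      (chartAt (EuclideanSpace ℝ (Fin n)) p).target := contMDiffOn_chart_symm
  have h2 := h1.contMDiffOn_tangentMapWithin (m := ∞) le_rfl
    (chartAt (EuclideanSpace ℝ (Fin n)) p).open_target.uniqueMDiffOn
  have h3 : ContMDiff (𝓡 n) (𝓡 n).tangent ∞ (fun u : EuclideanSpace ℝ (Fin n) =>
      (⟨u, EuclideanSpace.single i (1 : ℝ)⟩ : TangentBundle (𝓡 n) (EuclideanSpace ℝ (Fin n)))) :=
    contMDiff_vectorSpace_iff_contDiff.2 contDiff_const
  have h4 := h2.comp (h3.contMDiffOn (s := (chartAt (EuclideanSpace ℝ (Fin n)) p).target))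
    (fun u hu => hu)
  refine h4.congr fun u hu => ?_
  simp only [Function.comp, tangentMapWithin]
  congr 1
  rw [mfderivWithin_of_isOpen (chartAt (EuclideanSpace ℝ (Fin n)) p).open_target hu]
  rfl

/-- No differentiability is needed: the chart is a diffeomorphism, so both sides take their default
value 0 together. -/
theorem mfderiv_comp_coordMap (f : M → ℝ) {p : M} {u : EuclideanSpace ℝ (Fin n)}
    (hu : u ∈ (chartAt (EuclideanSpace ℝ (Fin n)) p).target) (a : EuclideanSpace ℝ (Fin n)) :
    mfderiv (𝓡 n) 𝓘(ℝ, ℝ) f ((chartAt (EuclideanSpace ℝ (Fin n)) p).symm u) (coordMap p u a) =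
      fderiv ℝ (f ∘ (chartAt (EuclideanSpace ℝ (Fin n)) p).symm) u a := by
  by_cases hf : MDifferentiableAt (𝓡 n) 𝓘(ℝ, ℝ) f ((chartAt (EuclideanSpace ℝ (Fin n)) p).symm u)
  · have := mfderiv_comp u hf (mdifferentiableAt_chart_symm hu)
    rw [← mfderiv_eq_fderiv, this]
    rfl
  · have h2 : ¬ DifferentiableAt ℝ (f ∘ (chartAt (EuclideanSpace ℝ (Fin n)) p).symm) u := by
      intro h
      apply hf
      have hx := (chartAt (EuclideanSpace ℝ (Fin n)) p).map_target hu
      have h3 : MDifferentiableAt (𝓡 n) 𝓘(ℝ, ℝ)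
          (f ∘ (chartAt (EuclideanSpace ℝ (Fin n)) p).symm)
            (chartAt (EuclideanSpace ℝ (Fin n)) p
              ((chartAt (EuclideanSpace ℝ (Fin n)) p).symm u)) := by
        rw [(chartAt (EuclideanSpace ℝ (Fin n)) p).right_inv hu]
        exact h.mdifferentiableAt
      refine (h3.comp _ (mdifferentiableAt_chart hx)).congr_of_eventuallyEq ?_
      filter_upwards [(chartAt (EuclideanSpace ℝ (Fin n)) p).open_source.mem_nhds hx] with y hy
      simp [(chartAt (EuclideanSpace ℝ (Fin n)) p).left_inv hy]
    rw [mfderiv_zero_of_not_mdifferentiableAt hf, fderiv_zero_of_not_differentiableAt h2]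
    rfl

variable [RiemannianBundle (fun x : M => TangentSpace (𝓡 n) x)]

theorem gram_posDef {p : M} {u : EuclideanSpace ℝ (Fin n)}
    (hu : u ∈ (chartAt (EuclideanSpace ℝ (Fin n)) p).target) : (gram p u).PosDef := by
  refine Matrix.PosDef.of_dotProduct_mulVec_pos ?_ ?_
  · ext i j
    simp [gram, real_inner_comm]
  · intro a ha
    have := inner_coordMap p u (WithLp.toLp 2 a) (WithLp.toLp 2 a)
    simp only [star_trivial] at *
    rw [← this]
    refine real_inner_self_pos.2 fun h => ha ?_
    have h0 : (WithLp.toLp 2 a : EuclideanSpace ℝ (Fin n)) = 0 :=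
      (coordMap_bijective hu).1 (by rw [h, map_zero])
    simpa using congrArg WithLp.ofLp h0

/-- The partial derivatives of `f` in the chart at `p`. -/
noncomputable def partials (f : M → ℝ) (p : M) (u : EuclideanSpace ℝ (Fin n)) : Fin n → ℝ :=
  fun i => fderiv ℝ (f ∘ (chartAt (EuclideanSpace ℝ (Fin n)) p).symm) u (EuclideanSpace.single i 1)

/-- The formula gⁱʲ ∂ᵢf ∂ⱼg, valid for arbitrary functions. It is the bridge by which measurability,
continuity and limits of gradients are checked in Euclidean space. -/
theorem inner_grad_grad (f g : M → ℝ) {p : M} {u : EuclideanSpace ℝ (Fin n)}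
    (hu : u ∈ (chartAt (EuclideanSpace ℝ (Fin n)) p).target) :
    inner ℝ (grad (n := n) f ((chartAt (EuclideanSpace ℝ (Fin n)) p).symm u))
      (grad (n := n) g ((chartAt (EuclideanSpace ℝ (Fin n)) p).symm u)) =
    partials f p u ⬝ᵥ (gram p u)⁻¹.mulVec (partials g p u) := by
  -- The components `b` of the gradient of `g` satisfy `gram * b = partials g`.
  obtain ⟨b, hb⟩ := (coordMap_bijective hu).2
    (grad (n := n) g ((chartAt (EuclideanSpace ℝ (Fin n)) p).symm u))
  have hi (i : Fin n) : coordMap p u (EuclideanSpace.single i 1) = coordField p u i := rfl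
  have h1 : partials g p u = (gram p u).mulVec b.ofLp := by
    ext i
    rw [partials, ← mfderiv_comp_coordMap g hu, ← inner_grad, ← hb, real_inner_comm,
      inner_coordMap]
    simp
  have h2 : (gram p u)⁻¹.mulVec (partials g p u) = b.ofLp := by
    rw [h1, Matrix.mulVec_mulVec, Matrix.nonsing_inv_mul _ (gram_posDef hu).det_pos.ne'.isUnit,
      Matrix.one_mulVec]
  rw [h2, ← hb, coordMap_eq_sum, inner_sum]
  simp only [dotProduct, inner_smul_right]
  refine Finset.sum_congr rfl fun i _ => ?_
  rw [mul_comm, ← hi, inner_grad, mfderiv_comp_coordMap f hu]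
  rfl

variable [IsContMDiffRiemannianBundle (𝓡 n) ∞ (EuclideanSpace ℝ (Fin n))
      (fun x : M => TangentSpace (𝓡 n) x)]

theorem continuousOn_gram (p : M) :
    ContinuousOn (gram p) (chartAt (EuclideanSpace ℝ (Fin n)) p).target := by
  refine continuousOn_pi.2 fun i => continuousOn_pi.2 fun j => ?_
  exact (ContMDiffOn.inner_bundle (contMDiffOn_coordField p i)
    (contMDiffOn_coordField p j)).continuousOn

theorem continuousOn_gram_inv (p : M) :
    ContinuousOn (fun u => (gram p u)⁻¹) (chartAt (EuclideanSpace ℝ (Fin n)) p).target := by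
  intro u hu
  have h := (continuousOn_gram p) u hu
  have hdet : ContinuousWithinAt (fun u => (gram p u).det)
    (chartAt (EuclideanSpace ℝ (Fin n)) p).target u := (continuous_id.matrix_det.tendsto _).comp h
  have hadj : ContinuousWithinAt (fun u => (gram p u).adjugate)
    (chartAt (EuclideanSpace ℝ (Fin n)) p).target u :=
      (continuous_id.matrix_adjugate.tendsto _).comp h
  simp only [Matrix.inv_def, Ring.inverse_eq_inv']
  exact (hdet.inv₀ (gram_posDef hu).det_pos.ne').smul hadj

theorem continuousOn_volDensity (p : M) :
    ContinuousOn (volDensity p) (chartAt (EuclideanSpace ℝ (Fin n)) p).target := by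
  intro u hu
  exact (Real.continuous_sqrt.tendsto _).comp
    ((continuous_id.matrix_det.tendsto _).comp (continuousOn_gram p u hu))

end Gram

/-! ### Change of charts. -/

section Transition

variable {n : ℕ} {M : Type*} [TopologicalSpace M]
    [ChartedSpace (EuclideanSpace ℝ (Fin n)) M] [IsManifold (𝓡 n) ∞ M]

theorem differentiableAt_transition {p p' : M} {u : EuclideanSpace ℝ (Fin n)}
    (hu : u ∈ (chartAt (EuclideanSpace ℝ (Fin n)) p).target)
    (hu' : (chartAt (EuclideanSpace ℝ (Fin n)) p).symm u ∈
      (chartAt (EuclideanSpace ℝ (Fin n)) p').source) :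
    DifferentiableAt ℝ (chartAt (EuclideanSpace ℝ (Fin n)) p' ∘
      (chartAt (EuclideanSpace ℝ (Fin n)) p).symm) u :=
  ((mdifferentiableAt_chart hu').comp u (mdifferentiableAt_chart_symm hu)).differentiableAt

variable [RiemannianBundle (fun x : M => TangentSpace (𝓡 n) x)]

/-- The inner product depends on the base point, so equality of the derivatives alone does not
suffice; the base points are identified first. -/
theorem inner_mfderiv_congr {F G : EuclideanSpace ℝ (Fin n) → M} {u : EuclideanSpace ℝ (Fin n)}
    (h : F =ᶠ[𝓝 u] G) (a b : EuclideanSpace ℝ (Fin n)) :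
    inner ℝ (mfderiv (𝓡 n) (𝓡 n) F u a : TangentSpace (𝓡 n) (F u))
        (mfderiv (𝓡 n) (𝓡 n) F u b : TangentSpace (𝓡 n) (F u)) =
      inner ℝ (mfderiv (𝓡 n) (𝓡 n) G u a : TangentSpace (𝓡 n) (G u))
        (mfderiv (𝓡 n) (𝓡 n) G u b : TangentSpace (𝓡 n) (G u)) := by
  have key : ∀ (y z : M), y = z → ∀ (v w : TangentSpace (𝓡 n) y) (v' w' : TangentSpace (𝓡 n) z),
      @Eq (EuclideanSpace ℝ (Fin n)) v v' → @Eq (EuclideanSpace ℝ (Fin n)) w w' →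
      inner ℝ v w = inner ℝ v' w' := by
    rintro y _ rfl v w _ _ rfl rfl; rfl
  have h2 : (mfderiv (𝓡 n) (𝓡 n) F u : EuclideanSpace ℝ (Fin n) →L[ℝ] EuclideanSpace ℝ (Fin n)) =
    mfderiv (𝓡 n) (𝓡 n) G u := h.mfderiv_eq
  exact key _ _ h.eq_of_nhds _ _ _ _ (congrArg (fun T => T a) h2) (congrArg (fun T => T b) h2)

theorem inner_coordMap_transition {p p' : M} {u : EuclideanSpace ℝ (Fin n)}
    (hu : u ∈ (chartAt (EuclideanSpace ℝ (Fin n)) p).target)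
    (hu' : (chartAt (EuclideanSpace ℝ (Fin n)) p).symm u ∈
      (chartAt (EuclideanSpace ℝ (Fin n)) p').source) (a b : EuclideanSpace ℝ (Fin n)) :
    let τ := chartAt (EuclideanSpace ℝ (Fin n)) p' ∘ (chartAt (EuclideanSpace ℝ (Fin n)) p).symm
    inner ℝ (coordMap p u a) (coordMap p u b) =
      inner ℝ (coordMap p' (τ u) (fderiv ℝ τ u a)) (coordMap p' (τ u) (fderiv ℝ τ u b)) := by
  intro τ
  have h : (chartAt (EuclideanSpace ℝ (Fin n)) p).symm =ᶠ[𝓝 u]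
      (chartAt (EuclideanSpace ℝ (Fin n)) p').symm ∘ τ := by
    have := (chartAt (EuclideanSpace ℝ (Fin n)) p).continuousAt_symm hu
    filter_upwards [this.preimage_mem_nhds
      ((chartAt (EuclideanSpace ℝ (Fin n)) p').open_source.mem_nhds hu')] with y hy
    exact ((chartAt (EuclideanSpace ℝ (Fin n)) p').left_inv hy).symm
  have h1 := inner_mfderiv_congr h a b
  have hτ : MDifferentiableAt (𝓡 n) (𝓡 n) τ u :=
    (mdifferentiableAt_chart hu').comp u (mdifferentiableAt_chart_symm hu)
  have h2 := mfderiv_comp (I := 𝓡 n) (I' := 𝓡 n) (I'' := 𝓡 n) u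
    (mdifferentiableAt_chart_symm (p := p')
    ((chartAt (EuclideanSpace ℝ (Fin n)) p').map_source hu')) hτ
  rw [h2] at h1
  have h3 : mfderiv (𝓡 n) (𝓡 n) τ u = fderiv ℝ τ u := mfderiv_eq_fderiv
  rw [h3] at h1
  exact h1

/-- The Gram matrices are related by g = Jᵀ g' J with J the Jacobian matrix of the transition map;
take determinants and square roots. -/
theorem volDensity_transition {p p' : M} {u : EuclideanSpace ℝ (Fin n)}
    (hu : u ∈ (chartAt (EuclideanSpace ℝ (Fin n)) p).target)
    (hu' : (chartAt (EuclideanSpace ℝ (Fin n)) p).symm u ∈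
      (chartAt (EuclideanSpace ℝ (Fin n)) p').source) :
    let τ := chartAt (EuclideanSpace ℝ (Fin n)) p' ∘ (chartAt (EuclideanSpace ℝ (Fin n)) p).symm
    volDensity p u = |(fderiv ℝ τ u).det| * volDensity p' (τ u) := by
  intro τ
  set B := (EuclideanSpace.basisFun (Fin n) ℝ).toBasis with hB
  set J : Matrix (Fin n) (Fin n) ℝ := LinearMap.toMatrix B B (fderiv ℝ τ u : _ →ₗ[ℝ] _) with hJ
  have hJv (a : EuclideanSpace ℝ (Fin n)) : (fderiv ℝ τ u a).ofLp = J.mulVec a.ofLp := by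
    have := LinearMap.toMatrix_mulVec_repr B B (fderiv ℝ τ u : _ →ₗ[ℝ] _) a
    ext i
    have := congrFun this i
    simp only [hB, OrthonormalBasis.coe_toBasis_repr_apply, EuclideanSpace.basisFun_repr,
      ContinuousLinearMap.coe_coe] at this
    rw [← this, hJ]
    congr 2
  have hg : gram p u = J.transpose * gram p' (τ u) * J := by
    ext i j
    have h1 := inner_coordMap_transition hu hu' (EuclideanSpace.single i 1)
      (EuclideanSpace.single j 1)
    simp only at h1
    rw [inner_coordMap, inner_coordMap, hJv, hJv] at h1
    have e (A : Matrix (Fin n) (Fin n) ℝ) :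
        (EuclideanSpace.single i (1 : ℝ)).ofLp ⬝ᵥ A.mulVec (EuclideanSpace.single j (1 : ℝ)).ofLp =
          A i j := by simp
    rw [e, Matrix.dotProduct_mulVec, ← Matrix.mulVec_transpose, Matrix.mulVec_mulVec,
      dotProduct_comm, Matrix.dotProduct_mulVec, ← Matrix.mulVec_transpose, Matrix.mulVec_mulVec,
      dotProduct_comm, e] at h1
    rw [h1, ← Matrix.transpose_apply (_ * _) j i]
    simp only [Matrix.transpose_apply, Matrix.transpose_mul, Matrix.transpose_transpose,
      Matrix.mul_assoc]
    rfl
  have hdet : J.det = (fderiv ℝ τ u).det := LinearMap.det_toMatrix B _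
  rw [volDensity_eq, volDensity_eq, hg, Matrix.det_mul, Matrix.det_mul, Matrix.det_transpose,
    ← hdet, mul_right_comm, ← sq, Real.sqrt_mul (sq_nonneg _), Real.sqrt_sq_eq_abs]

end Transition

/-! ### The Riemannian volume measure. -/

section Volume

theorem exists_seq_cover_source (n : ℕ) (M : Type*) [TopologicalSpace M]
    [ChartedSpace (EuclideanSpace ℝ (Fin n)) M] [SecondCountableTopology M] [Nonempty M] :
    ∃ s : ℕ → M, ⋃ k, (chartAt (EuclideanSpace ℝ (Fin n)) (s k)).source = univ := by
  obtain ⟨t, htc, ht⟩ := TopologicalSpace.countable_cover_nhds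
    (fun x : M => (chartAt (EuclideanSpace ℝ (Fin n)) x).open_source.mem_nhds
      (mem_chart_source (EuclideanSpace ℝ (Fin n)) x))
  have hne : t.Nonempty := by
    by_contra h
    rw [not_nonempty_iff_eq_empty] at h
    exact empty_ne_univ (by simpa [h] using ht)
  obtain ⟨s, rfl⟩ := htc.exists_eq_range hne
  exact ⟨s, by simpa using ht⟩

variable {n : ℕ} {M : Type*} [TopologicalSpace M]
    [ChartedSpace (EuclideanSpace ℝ (Fin n)) M] [MeasurableSpace M] [BorelSpace M]

theorem measurableSet_chart_symm_preimage (p : M) {A : Set M} (hA : MeasurableSet A) :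
    MeasurableSet ((chartAt (EuclideanSpace ℝ (Fin n)) p).symm ⁻¹' A ∩
      (chartAt (EuclideanSpace ℝ (Fin n)) p).target) := by
  set e := chartAt (EuclideanSpace ℝ (Fin n)) p
  have h : Measurable (fun u : e.target => e.symm u) :=
    (continuousOn_iff_continuous_domRestrict.1 e.continuousOn_symm).measurable
  have := e.open_target.measurableSet.subtype_image (h hA)
  convert this using 1
  ext u
  simp only [mem_inter_iff, mem_preimage, mem_image, Subtype.exists, exists_and_left,
    exists_prop, exists_eq_right_right]

theorem measurableSet_chart_preimage (p : M) {A : Set (EuclideanSpace ℝ (Fin n))}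
    (hA : MeasurableSet A) :
    MeasurableSet ((chartAt (EuclideanSpace ℝ (Fin n)) p) ⁻¹' A ∩
      (chartAt (EuclideanSpace ℝ (Fin n)) p).source) := by
  set e := chartAt (EuclideanSpace ℝ (Fin n)) p
  have h : Measurable (fun u : e.source => e u) :=
    (continuousOn_iff_continuous_domRestrict.1 e.continuousOn).measurable
  have := e.open_source.measurableSet.subtype_image (h hA)
  convert this using 1
  ext u
  simp only [mem_inter_iff, mem_preimage, mem_image, Subtype.exists, exists_and_left,
    exists_prop, exists_eq_right_right]

variable [RiemannianBundle (fun x : M => TangentSpace (𝓡 n) x)]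

theorem chartVolume_apply (p : M) {A : Set M} (hA : MeasurableSet A) :
    chartVolume (n := n) p A =
      ∫⁻ u in (chartAt (EuclideanSpace ℝ (Fin n)) p).symm ⁻¹' A ∩
        (chartAt (EuclideanSpace ℝ (Fin n)) p).target, ENNReal.ofReal (volDensity p u) := by
  set e := chartAt (EuclideanSpace ℝ (Fin n)) p
  have hm : AEMeasurable e.symm (((volume : Measure (EuclideanSpace ℝ (Fin n))).restrict
      e.target).withDensity (fun u => ENNReal.ofReal (volDensity p u))) :=
    (e.continuousOn_symm.aemeasurable e.open_target.measurableSet).mono_ac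
      (withDensity_absolutelyContinuous _ _)
  rw [chartVolume, Measure.map_apply_of_aemeasurable hm hA, withDensity_apply',
    Measure.restrict_restrict' e.open_target.measurableSet]

theorem chartVolume_compl_source (p : M) :
    chartVolume (n := n) p (chartAt (EuclideanSpace ℝ (Fin n)) p).sourceᶜ = 0 := by
  rw [chartVolume_apply p (chartAt (EuclideanSpace ℝ (Fin n)) p).open_source.measurableSet.compl]
  have : (chartAt (EuclideanSpace ℝ (Fin n)) p).symm ⁻¹'
    (chartAt (EuclideanSpace ℝ (Fin n)) p).sourceᶜ ∩
      (chartAt (EuclideanSpace ℝ (Fin n)) p).target = ∅ := by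
    ext u
    simp only [mem_inter_iff, mem_preimage, mem_compl_iff, mem_empty_iff_false, iff_false, not_and]
    intro h hu
    exact h ((chartAt (EuclideanSpace ℝ (Fin n)) p).map_target hu)
  rw [this, Measure.restrict_empty, lintegral_zero_measure]

theorem chartVolume_inter_source (p : M) (A : Set M) :
    chartVolume (n := n) p (A ∩ (chartAt (EuclideanSpace ℝ (Fin n)) p).source) =
      chartVolume (n := n) p A :=
  measure_inter_conull (chartVolume_compl_source p)

variable [IsManifold (𝓡 n) ∞ M]

/-- The volume measures of two charts agree where their domains overlap. -/
theorem chartVolume_eq_of_subset {p p' : M} {A : Set M} (hA : MeasurableSet A)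
    (h : A ⊆ (chartAt (EuclideanSpace ℝ (Fin n)) p).source)
    (h' : A ⊆ (chartAt (EuclideanSpace ℝ (Fin n)) p').source) :
    chartVolume (n := n) p A = chartVolume (n := n) p' A := by
  set e := chartAt (EuclideanSpace ℝ (Fin n)) p with he
  set e' := chartAt (EuclideanSpace ℝ (Fin n)) p' with he'
  -- The two coordinate images of `A` correspond under the transition map, so the change of
  -- variables formula applies.
  have himg : e'.symm ⁻¹' A ∩ e'.target = (e' ∘ e.symm) '' (e.symm ⁻¹' A ∩ e.target) := by
    ext v
    constructor
    · rintro ⟨hv, hvt⟩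
      refine ⟨e (e'.symm v), ⟨?_, e.map_source (h hv)⟩, ?_⟩
      · rw [mem_preimage, e.left_inv (h hv)]; exact hv
      · simp [e.left_inv (h hv), e'.right_inv hvt]
    · rintro ⟨u, ⟨hu, hut⟩, rfl⟩
      refine ⟨?_, e'.map_source (h' hu)⟩
      simp only [mem_preimage, Function.comp]
      rw [e'.left_inv (h' hu)]; exact hu
  rw [chartVolume_apply p hA, chartVolume_apply p' hA, himg,
    lintegral_image_eq_lintegral_abs_det_fderiv_mul volume
      (measurableSet_chart_symm_preimage p hA)
      (f' := fun u => fderiv ℝ (e' ∘ e.symm) u)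
      (fun u hu => (differentiableAt_transition hu.2 (h' hu.1)).hasFDerivAt.hasFDerivWithinAt)]
  · refine setLIntegral_congr_fun (measurableSet_chart_symm_preimage p hA) fun u hu => ?_
    rw [volDensity_transition hu.2 (h' hu.1), ENNReal.ofReal_mul (abs_nonneg _)]
  · rintro u ⟨hu, hut⟩ v ⟨hv, hvt⟩ huv
    have := e'.injOn (h' hu) (h' hv) huv
    exact e.symm.injOn hut hvt this

/-- On the domain of a chart, the Riemannian volume is the volume measure of the chart. -/
theorem riemVolume_apply_of_subset_source [SecondCountableTopology M] {p : M} {A : Set M}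
    (hA : MeasurableSet A) (h : A ⊆ (chartAt (EuclideanSpace ℝ (Fin n)) p).source) :
    riemVolume n M A = chartVolume (n := n) p A := by
  refine le_antisymm ?_ (le_iSup (fun p : M => chartVolume (n := n) p) p A)
  have : Nonempty M := ⟨p⟩
  obtain ⟨s, hs⟩ := exists_seq_cover_source n M
  set D : ℕ → Set M := disjointed fun k => (chartAt (EuclideanSpace ℝ (Fin n)) (s k)).source
  have hDm (k : ℕ) : MeasurableSet (D k) :=
    MeasurableSet.disjointed (fun k => (chartAt _ (s k)).open_source.measurableSet) k
  have hDs (k : ℕ) : D k ⊆ (chartAt (EuclideanSpace ℝ (Fin n)) (s k)).source :=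
    disjointed_subset _ k
  have hDu : ⋃ k, D k = univ := by rw [iUnion_disjointed, hs]
  have hDd : Pairwise (Function.onFun Disjoint D) := disjoint_disjointed _
  have hdec (μ : Measure M) {B : Set M} (hB : MeasurableSet B) : μ B = ∑' k, μ (B ∩ D k) := by
    rw [← measure_iUnion (fun i j hij => (hDd hij).mono inter_subset_right inter_subset_right)
      (fun k => hB.inter (hDm k)), ← inter_iUnion, hDu, inter_univ]
  -- Gluing the chart measures along a countable partition into pieces of chart domains gives a
  -- measure that dominates every chart measure, hence their supremum.
  set ν : Measure M := Measure.sum fun k => (chartVolume (n := n) (s k)).restrict (D k)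
  have hν {B : Set M} (hB : MeasurableSet B) :
      ν B = ∑' k, chartVolume (n := n) (s k) (B ∩ D k) := by
    rw [Measure.sum_apply _ hB]
    simp_rw [Measure.restrict_apply hB]
  have hle : riemVolume n M ≤ ν := by
    refine iSup_le fun p' => Measure.le_iff.2 fun B hB => ?_
    rw [hν hB, hdec _ hB]
    refine ENNReal.tsum_le_tsum fun k => ?_
    rw [← chartVolume_inter_source p']
    rw [chartVolume_eq_of_subset (p' := s k) ((hB.inter (hDm k)).inter
      (chartAt _ p').open_source.measurableSet) inter_subset_right
      (fun x hx => hDs k hx.1.2)]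
    exact measure_mono inter_subset_left
  refine (hle A).trans ?_
  rw [hν hA, hdec (chartVolume (n := n) p) hA]
  refine ENNReal.tsum_le_tsum fun k => ?_
  rw [chartVolume_eq_of_subset (p' := p) (hA.inter (hDm k)) (fun x hx => hDs k hx.2)
    (fun x hx => h hx.1)]

/-- What holds almost everywhere in a chart holds almost everywhere on its domain. -/
theorem ae_riemVolume_of_ae_chart [SecondCountableTopology M] (p : M)
    {P : EuclideanSpace ℝ (Fin n) → Prop} (h : ∀ᵐ u, P u) :
    ∀ᵐ x ∂(riemVolume n M), x ∈ (chartAt (EuclideanSpace ℝ (Fin n)) p).source →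
      P (chartAt (EuclideanSpace ℝ (Fin n)) p x) := by
  set e := chartAt (EuclideanSpace ℝ (Fin n)) p
  obtain ⟨N, hN, hNm, hN0⟩ := exists_measurable_superset_of_null (ae_iff.1 h)
  have hB := measurableSet_chart_preimage p hNm
  have h0 : riemVolume n M (e ⁻¹' N ∩ e.source) = 0 := by
    rw [riemVolume_apply_of_subset_source hB inter_subset_right, chartVolume_apply p hB]
    refine setLIntegral_measure_zero _ _ (measure_mono_null ?_ hN0)
    rintro u ⟨⟨hu, -⟩, hut⟩
    rwa [mem_preimage, e.right_inv hut] at hu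
  refine ae_iff.2 (measure_mono_null ?_ h0)
  intro x hx
  simp only [mem_ofPred_eq, Classical.not_imp] at hx
  exact ⟨hN hx.2, hx.1⟩

variable [IsContMDiffRiemannianBundle (𝓡 n) ∞ (EuclideanSpace ℝ (Fin n))
      (fun x : M => TangentSpace (𝓡 n) x)]

/-- The continuous volume density is bounded on a small closed coordinate ball. -/
instance isLocallyFiniteMeasure_riemVolume [SecondCountableTopology M] :
    IsLocallyFiniteMeasure (riemVolume n M) := by
  refine ⟨fun p => ?_⟩
  set e := chartAt (EuclideanSpace ℝ (Fin n)) p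
  have hp : p ∈ e.source := mem_chart_source _ p
  obtain ⟨r, hr, hrt⟩ := Metric.nhds_basis_closedBall.mem_iff.1
    (e.open_target.mem_nhds (e.map_source hp))
  obtain ⟨c, hc⟩ := (isCompact_closedBall (e p) r).exists_bound_of_continuousOn
    ((continuousOn_volDensity p).mono hrt)
  have hB := measurableSet_chart_preimage p (Metric.isOpen_ball (x := e p) (ε := r)).measurableSet
  refine ⟨e ⁻¹' Metric.ball (e p) r ∩ e.source, ?_, ?_⟩
  · exact inter_mem ((e.continuousAt hp).preimage_mem_nhds (Metric.ball_mem_nhds _ hr))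
      (e.open_source.mem_nhds hp)
  · rw [riemVolume_apply_of_subset_source hB inter_subset_right, chartVolume_apply p hB]
    calc _ ≤ ∫⁻ u in Metric.closedBall (e p) r, ENNReal.ofReal (volDensity p u) := by
          refine lintegral_mono_set ?_
          rintro u ⟨⟨hu, -⟩, hut⟩
          rw [mem_preimage, e.right_inv hut] at hu
          exact Metric.ball_subset_closedBall hu
      _ ≤ ∫⁻ u in Metric.closedBall (e p) r, ENNReal.ofReal c := by
          refine setLIntegral_mono measurable_const fun u hu => ENNReal.ofReal_le_ofReal ?_
          exact (le_abs_self _).trans (hc u hu)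
      _ < ⊤ := by
          rw [setLIntegral_const]
          exact ENNReal.mul_lt_top ENNReal.ofReal_lt_top measure_closedBall_lt_top

/-- Nothing is asked of the functions, since `fderiv` of any real function on Euclidean space is
measurable; countably many charts suffice. -/
theorem aemeasurable_inner_grad [SecondCountableTopology M] (f g : M → ℝ) :
    AEMeasurable (fun x => inner ℝ (grad (n := n) f x) (grad (n := n) g x))
      (riemVolume n M) := by
  rcases isEmpty_or_nonempty M with hM | hM
  · exact (measurable_of_empty _).aemeasurable
  obtain ⟨s, hs⟩ := exists_seq_cover_source n M
  rw [← Measure.restrict_univ (μ := riemVolume n M), ← hs, aemeasurable_iUnion_iff]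
  intro k
  set p := s k
  set e := chartAt (EuclideanSpace ℝ (Fin n)) p
  have hpm (f : M → ℝ) (i : Fin n) : Measurable fun u => partials f p u i :=
    measurable_fderiv_apply_const ℝ _ _
  have hgm (i j : Fin n) : Measurable (e.target.indicator fun u => (gram p u)⁻¹ i j) := by
    classical
    rw [← piecewise_eq_indicator]
    refine ContinuousOn.measurable_piecewise ?_ continuousOn_const e.open_target.measurableSet
    exact fun u hu => ((continuous_apply_apply i j).tendsto _).comp (continuousOn_gram_inv p u hu)
  have hG : Measurable fun u => ∑ i, partials f p u i *
      ∑ j, e.target.indicator (fun u => (gram p u)⁻¹ i j) u * partials g p u j :=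
    Finset.measurable_sum _ fun i _ => (hpm f i).mul
      (Finset.measurable_sum _ fun j _ => (hgm i j).mul (hpm g j))
  have he : AEMeasurable e ((riemVolume n M).restrict e.source) :=
    e.continuousOn.aemeasurable e.open_source.measurableSet
  refine (hG.comp_aemeasurable he).congr ?_
  filter_upwards [ae_restrict_mem e.open_source.measurableSet] with x hx
  have := inner_grad_grad f g (e.map_source hx)
  rw [e.left_inv hx] at this
  rw [this]
  simp only [Function.comp, dotProduct, Matrix.mulVec, indicator_of_mem (e.map_source hx)]

end Volume

/-! ### Compactness of closed balls, and Lipschitz charts. -/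

section HopfRinow

/-- **Hopf–Rinow**: in a complete locally compact length space, closed balls are compact. -/
theorem isCompact_closedBall_of_length {X : Type*} [MetricSpace X] [CompleteSpace X]
    [LocallyCompactSpace X]
    (hX : ∀ (x y : X) (r s : ℝ), 0 < r → 0 < s → dist x y < r + s →
      ∃ z, dist x z < r ∧ dist z y < s) (x : X) (r : ℝ) :
    IsCompact (Metric.closedBall x r) := by
  -- If some ball were not compact, the compact radii would be bounded; their supremum is shown to
  -- be a compact radius that can still be enlarged.
  set S : Set ℝ := {r | IsCompact (Metric.closedBall x r)}
  by_contra hr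
  have hbdd : BddAbove S := by
    refine ⟨r, fun s hs => ?_⟩
    by_contra! h
    exact hr (hs.of_isClosed_subset Metric.isClosed_closedBall (Metric.closedBall_subset_closedBall h.le))
  obtain ⟨K, hK, hKx⟩ := exists_compact_mem_nhds x
  obtain ⟨ε, hε, hεK⟩ := Metric.nhds_basis_closedBall.mem_iff.1 hKx
  have hεS : ε ∈ S := hK.of_isClosed_subset Metric.isClosed_closedBall hεK
  have hR : 0 < sSup S := hε.trans_le (le_csSup hbdd hεS)
  have hRS : IsCompact (Metric.closedBall x (sSup S)) := by
    refine isCompact_iff_totallyBounded_isComplete.2 ⟨?_, Metric.isClosed_closedBall.isComplete⟩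
    refine Metric.totallyBounded_iff.2 fun δ hδ => ?_
    obtain ⟨s, hs, hsR⟩ := exists_lt_of_lt_csSup ⟨ε, hεS⟩
      (max_lt hR (sub_lt_self (sSup S) (half_pos hδ)))
    obtain ⟨t, ht, htc⟩ := Metric.totallyBounded_iff.1 (show IsCompact _ from hs).totallyBounded
      (δ / 2) (half_pos hδ)
    refine ⟨t, ht, fun z hz => ?_⟩
    rw [Metric.mem_closedBall'] at hz
    -- Every point of the large ball lies within δ/2 of the compact ball of radius s > sup S - δ/2,
    -- so a finite δ/2-net of the latter is a δ-net of the former.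
    obtain ⟨w, hw, hwz⟩ := hX x z s (δ / 2) ((le_max_left _ _).trans_lt hsR) (half_pos hδ)
      (by linarith [(le_max_right _ _).trans_lt hsR])
    have := htc (show w ∈ Metric.closedBall x s from by
      rw [Metric.mem_closedBall']; exact hw.le)
    simp only [mem_iUnion, Metric.mem_ball, exists_prop] at this ⊢
    obtain ⟨y, hy, hyw⟩ := this
    refine ⟨y, hy, ?_⟩
    calc dist z y ≤ dist w z + dist w y := dist_triangle_left z y w
      _ < δ := by linarith
  obtain ⟨δ, hδ, hδc⟩ := hRS.exists_isCompact_cthickening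
  have : sSup S + δ / 2 ∈ S := by
    refine hδc.of_isClosed_subset Metric.isClosed_closedBall fun z hz => ?_
    rw [Metric.mem_closedBall'] at hz
    obtain ⟨w, hw, hwz⟩ := hX x z (sSup S) δ hR hδ (by linarith)
    refine Metric.thickening_subset_cthickening _ _ (Metric.mem_thickening_iff.2 ⟨w, ?_, ?_⟩)
    · rw [Metric.mem_closedBall']; exact hw.le
    · rwa [dist_comm]
  linarith [le_csSup hbdd this]

theorem norm_coordMap_le {n : ℕ} {M : Type*} [TopologicalSpace M]
    [ChartedSpace (EuclideanSpace ℝ (Fin n)) M]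
    [RiemannianBundle (fun x : M => TangentSpace (𝓡 n) x)] (p : M) (u a : EuclideanSpace ℝ (Fin n)) :
    ‖coordMap p u a‖ ≤ (∑ i, Real.sqrt (gram p u i i)) * ‖a‖ := by
  rw [coordMap_eq_sum, Finset.sum_mul]
  refine (norm_sum_le _ _).trans (Finset.sum_le_sum fun i _ => ?_)
  rw [norm_smul, mul_comm]
  refine mul_le_mul (le_of_eq ?_) (PiLp.norm_apply_le a i) (norm_nonneg _) (Real.sqrt_nonneg _)
  rw [norm_eq_sqrt_real_inner]
  rfl

variable {n : ℕ} {M : Type*} [MetricSpace M] [ChartedSpace (EuclideanSpace ℝ (Fin n)) M]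
    [RiemannianBundle (fun x : M => TangentSpace (𝓡 n) x)] [IsRiemannianManifold (𝓡 n) M]

variable (n) in
-- On a curve from x to y of length L < r + s, take a point at distance c from x with L - s < c < r;
-- the rest of the curve is shorter than s.
theorem exists_dist_lt_dist_lt [IsManifold (𝓡 n) ∞ M]
    [IsContMDiffRiemannianBundle (𝓡 n) ∞ (EuclideanSpace ℝ (Fin n))
      (fun x : M => TangentSpace (𝓡 n) x)] (x y : M) (r s : ℝ) (hr : 0 < r) (hs : 0 < s)
    (h : dist x y < r + s) : ∃ z, dist x z < r ∧ dist z y < s := by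
  rcases lt_or_ge (dist x y) r with hxy | hxy
  · exact ⟨y, hxy, by simpa using hs⟩
  have h1 : Manifold.riemannianEDist (𝓡 n) x y < ENNReal.ofReal (r + s) := by
    rw [← IsRiemannianManifold.out (I := 𝓡 n) x y, edist_dist]
    exact (ENNReal.ofReal_lt_ofReal_iff (by positivity)).2 h
  obtain ⟨γ, h0, h1', hγ, hL⟩ := Manifold.exists_lt_of_riemannianEDist_lt h1
  set L := Manifold.pathELength (𝓡 n) γ 0 1
  have hLtop : L ≠ ⊤ := (hL.trans ENNReal.ofReal_lt_top).ne
  have hL' : L.toReal < r + s := by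
    rwa [ENNReal.lt_ofReal_iff_toReal_lt hLtop] at hL
  obtain ⟨c, hc, hcr⟩ := exists_between (max_lt hr (show L.toReal - s < r by linarith))
  have hc0 := (le_max_left _ _).trans_lt hc
  have hcL := (le_max_right _ _).trans_lt hc
  have hcont : ContinuousOn (fun t => dist x (γ t)) (Icc 0 1) :=
    (continuous_const.dist continuous_id).comp_continuousOn hγ.continuousOn
  obtain ⟨t, ht, htc⟩ := intermediate_value_Icc zero_le_one hcont
    (show c ∈ Icc _ _ by simp only [h0, h1', dist_self]; exact ⟨hc0.le, hcr.le.trans hxy⟩)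
  simp only at htc
  refine ⟨γ t, by rw [htc]; exact hcr, ?_⟩
  have e1 : edist x (γ t) ≤ Manifold.pathELength (𝓡 n) γ 0 t := by
    rw [IsRiemannianManifold.out (I := 𝓡 n) x (γ t)]
    exact Manifold.riemannianEDist_le_pathELength (hγ.mono (Icc_subset_Icc_right ht.2)) h0 rfl ht.1
  have e2 : edist (γ t) y ≤ Manifold.pathELength (𝓡 n) γ t 1 := by
    rw [IsRiemannianManifold.out (I := 𝓡 n) (γ t) y]
    exact Manifold.riemannianEDist_le_pathELength (hγ.mono (Icc_subset_Icc_left ht.1)) rfl h1' ht.2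
  have e3 : edist x (γ t) + edist (γ t) y ≤ L := by
    refine (add_le_add e1 e2).trans_eq (Manifold.pathELength_add ht.1 ht.2)
  rw [edist_dist, edist_dist, ← ENNReal.ofReal_add dist_nonneg dist_nonneg, htc,
    ENNReal.ofReal_le_iff_le_toReal hLtop] at e3
  linarith

variable (n) in
theorem properSpace_of_isRiemannianManifold [IsManifold (𝓡 n) ∞ M]
    [IsContMDiffRiemannianBundle (𝓡 n) ∞ (EuclideanSpace ℝ (Fin n))
      (fun x : M => TangentSpace (𝓡 n) x)] [CompleteSpace M] : ProperSpace M :=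
  have : LocallyCompactSpace M := ChartedSpace.locallyCompactSpace (EuclideanSpace ℝ (Fin n)) M
  ⟨isCompact_closedBall_of_length (exists_dist_lt_dist_lt n)⟩

variable [IsManifold (𝓡 n) ∞ M] [IsContMDiffRiemannianBundle (𝓡 n) ∞ (EuclideanSpace ℝ (Fin n))
      (fun x : M => TangentSpace (𝓡 n) x)]

/-- On a small coordinate ball the Gram matrix is bounded, so the image of a segment is a curve of
length at most a constant times that of the segment. -/
theorem exists_lipschitzOnWith_chart_symm {p : M} {u : EuclideanSpace ℝ (Fin n)}
    (hu : u ∈ (chartAt (EuclideanSpace ℝ (Fin n)) p).target) :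
    ∃ K, ∃ t ∈ 𝓝 u, LipschitzOnWith K (chartAt (EuclideanSpace ℝ (Fin n)) p).symm t := by
  set e := chartAt (EuclideanSpace ℝ (Fin n)) p
  obtain ⟨r, hr, hrt⟩ := Metric.nhds_basis_closedBall.mem_iff.1 (e.open_target.mem_nhds hu)
  have hcont : ContinuousOn (fun v => ∑ i, Real.sqrt (gram p v i i)) (Metric.closedBall u r) := by
    refine continuousOn_finsetSum _ fun i _ => ?_
    exact fun v hv => (Real.continuous_sqrt.tendsto _).comp
      (((continuous_apply_apply i i).tendsto _).comp ((continuousOn_gram p).mono hrt v hv))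
  obtain ⟨c, hc⟩ := (isCompact_closedBall u r).exists_bound_of_continuousOn hcont
  refine ⟨c.toNNReal, Metric.closedBall u r, Metric.closedBall_mem_nhds u hr, ?_⟩
  intro y hy z hz
  set l : ℝ → EuclideanSpace ℝ (Fin n) := fun t => y + t • (z - y)
  have hlmem : ∀ t ∈ Icc (0 : ℝ) 1, l t ∈ Metric.closedBall u r := fun t ht =>
    (convex_closedBall u r).add_smul_sub_mem hy hz ht
  have hld (t : ℝ) : HasDerivAt l (z - y) t := by
    have h := ((hasDerivAt_id t).smul_const (z - y)).const_add y
    rw [one_smul] at h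
    exact h
  have hlc : ContDiff ℝ 1 l := by fun_prop
  have hγ : ContMDiffOn 𝓘(ℝ, ℝ) (𝓡 n) 1 (e.symm ∘ l) (Icc 0 1) := by
    have h1 : ContMDiffOn (𝓡 n) (𝓡 n) ∞ e.symm e.target := contMDiffOn_chart_symm
    exact (h1.of_le (by norm_cast)).comp hlc.contMDiff.contMDiffOn
      (fun t ht => hrt (hlmem t ht))
  rw [IsRiemannianManifold.out (I := 𝓡 n) (e.symm y) (e.symm z)]
  refine (Manifold.riemannianEDist_le_pathELength hγ (by simp [l]) (by simp [l])
    zero_le_one).trans ?_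
  rw [Manifold.pathELength_eq_lintegral_mfderiv_Icc]
  calc _ ≤ ∫⁻ t in Icc (0 : ℝ) 1, ENNReal.ofReal (c * ‖z - y‖) := by
        refine setLIntegral_mono measurable_const fun t ht => ?_
        have hd : mfderiv 𝓘(ℝ, ℝ) (𝓡 n) (e.symm ∘ l) t (1 : ℝ) = coordMap p (l t) (z - y) := by
          have h2 := mfderiv_comp (I := 𝓘(ℝ, ℝ)) (I' := 𝓡 n) (I'' := 𝓡 n) t
            (mdifferentiableAt_chart_symm (p := p) (hrt (hlmem t ht)))
            (hld t).differentiableAt.mdifferentiableAt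
          rw [h2, mfderiv_eq_fderiv]
          show coordMap p (l t) (fderiv ℝ l t 1) = _
          rw [fderiv_apply_one_eq_deriv, (hld t).deriv]
        refine le_of_eq_of_le
          (congrArg (fun v : TangentSpace (𝓡 n) ((e.symm ∘ l) t) => ‖v‖ₑ) hd) ?_
        simp only [← ofReal_norm]
        refine ENNReal.ofReal_le_ofReal ((norm_coordMap_le p _ _).trans ?_)
        exact mul_le_mul_of_nonneg_right ((le_abs_self _).trans (hc _ (hlmem t ht)))
          (norm_nonneg _)
    _ = _ := by
        rw [setLIntegral_const, Real.volume_Icc]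
        have hc0 : 0 ≤ c := (norm_nonneg _).trans (hc y hy)
        rw [ENNReal.ofReal_mul hc0, edist_comm, edist_dist, dist_eq_norm]
        simp [ENNReal.ofReal]

/-- A locally Lipschitz function is locally Lipschitz in the charts. -/
theorem exists_lipschitzOnWith_comp_chart_symm {f : M → ℝ} (hf : LocallyLipschitz f) {p : M}
    {u : EuclideanSpace ℝ (Fin n)} (hu : u ∈ (chartAt (EuclideanSpace ℝ (Fin n)) p).target) :
    ∃ K, ∃ t ∈ 𝓝 u, LipschitzOnWith K (f ∘ (chartAt (EuclideanSpace ℝ (Fin n)) p).symm) t := by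
  obtain ⟨K, t, ht, hK⟩ := exists_lipschitzOnWith_chart_symm hu
  obtain ⟨K', s, hs, hK'⟩ := hf ((chartAt (EuclideanSpace ℝ (Fin n)) p).symm u)
  have hc := (chartAt (EuclideanSpace ℝ (Fin n)) p).continuousAt_symm hu
  refine ⟨K' * K, t ∩ (chartAt (EuclideanSpace ℝ (Fin n)) p).symm ⁻¹' s,
    inter_mem ht (hc.preimage_mem_nhds hs), ?_⟩
  exact hK'.comp (hK.mono inter_subset_left) fun v hv => hv.2

end HopfRinow

/-! ### Mollification of Lipschitz functions on Euclidean space. -/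

section Mollification

/-- Compactness gives a Lipschitz constant on the 1-thickening of the support. A point outside it is
at distance at least 1 from the support, where the bound on |g| serves as Lipschitz constant. -/
theorem exists_lipschitzWith_of_hasCompactSupport {E : Type*} [NormedAddCommGroup E]
    [ProperSpace E] {g : E → ℝ} (hc : HasCompactSupport g)
    (h : ∀ u ∈ tsupport g, ∃ K, ∃ t ∈ 𝓝 u, LipschitzOnWith K g t) :
    ∃ L, LipschitzWith L g := by
  have hloc : LocallyLipschitz g := by
    intro u
    by_cases hu : u ∈ tsupport g
    · exact h u hu
    · refine ⟨0, (tsupport g)ᶜ, (isClosed_tsupport g).isOpen_compl.mem_nhds hu, ?_⟩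
      intro x hx y hy
      simp [image_eq_zero_of_notMem_tsupport hx, image_eq_zero_of_notMem_tsupport hy]
  have hcomp : IsCompact (Metric.cthickening 1 (tsupport g)) := hc.isCompact.cthickening
  obtain ⟨L₁, hL₁⟩ := hloc.locallyLipschitzOn.exists_lipschitzOnWith_of_compact hcomp
  obtain ⟨B, hB⟩ := hc.exists_bound_of_continuous hloc.continuous
  have key : ∀ x ∈ tsupport g, ∀ y, dist (g x) (g y) ≤ max (L₁ : ℝ) B * dist x y := by
    intro x hx y
    by_cases hy : y ∈ Metric.cthickening 1 (tsupport g)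
    · refine (hL₁.dist_le_mul x (Metric.self_subset_cthickening _ hx) y hy).trans ?_
      gcongr
      exact le_max_left _ _
    · have h1 : 1 ≤ dist x y := by
        by_contra! hlt
        exact hy (Metric.mem_cthickening_of_dist_le y x 1 _ hx (by rw [dist_comm]; exact hlt.le))
      have h0 : g y = 0 :=
        image_eq_zero_of_notMem_tsupport fun hy' => hy (Metric.self_subset_cthickening _ hy')
      have hB0 : 0 ≤ B := (norm_nonneg _).trans (hB x)
      rw [h0, dist_zero_right]
      calc ‖g x‖ ≤ B * 1 := by simpa using hB x
        _ ≤ max (L₁ : ℝ) B * dist x y := by gcongr; exact le_max_right _ _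
  refine ⟨(max (L₁ : ℝ) B).toNNReal, LipschitzWith.of_dist_le_mul fun x y => ?_⟩
  have hL : 0 ≤ max (L₁ : ℝ) B := le_max_of_le_left L₁.2
  rw [Real.coe_toNNReal _ hL]
  by_cases hx : x ∈ tsupport g
  · exact key x hx y
  by_cases hy : y ∈ tsupport g
  · rw [dist_comm, dist_comm x]; exact key y hy x
  · rw [image_eq_zero_of_notMem_tsupport hx, image_eq_zero_of_notMem_tsupport hy, dist_self]
    exact mul_nonneg hL dist_nonneg

variable {E : Type*} [NormedAddCommGroup E] [InnerProductSpace ℝ E] [FiniteDimensional ℝ E]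
  [MeasurableSpace E] [BorelSpace E]

/-- The derivative of the mollification of a Lipschitz function is the mollification of its
derivative. -/
theorem hasFDerivAt_convolution_of_lipschitz {g : E → ℝ} {L : ℝ≥0} (hg : LipschitzWith L g)
    (φ : ContDiffBump (0 : E)) (x : E) :
    HasFDerivAt (φ.normed volume ⋆[ContinuousLinearMap.lsmul ℝ ℝ, volume] g)
      ((φ.normed volume ⋆[ContinuousLinearMap.lsmul ℝ ℝ, volume] fderiv ℝ g) x) x := by
  have hφc : Continuous (φ.normed volume) := φ.continuous_normed
  have hφs : HasCompactSupport (φ.normed volume) := φ.hasCompactSupport_normed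
  have hcont (y : E) : Continuous fun t => φ.normed volume t • g (y - t) :=
    hφc.smul (hg.continuous.comp (continuous_const.sub continuous_id))
  refine (hasFDerivAt_integral_of_dominated_loc_of_lip (μ := volume) (s := univ) (𝕜 := ℝ)
    (F := fun y t => φ.normed volume t • g (y - t))
    (F' := fun t => φ.normed volume t • fderiv ℝ g (x - t))
    (bound := fun t => φ.normed volume t * L)
    univ_mem (Eventually.of_forall fun y => (hcont y).aestronglyMeasurable) ?_ ?_ ?_ ?_ ?_).2
  · exact (hcont x).integrable_of_hasCompactSupport (hφs.smul_right)
  · exact (hφc.measurable.smul ((measurable_fderiv ℝ g).comp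
      (measurable_const.sub measurable_id))).aestronglyMeasurable
  · refine Eventually.of_forall fun t => LipschitzWith.lipschitzOnWith ?_
    refine LipschitzWith.of_dist_le_mul fun y z => ?_
    have h0 : 0 ≤ φ.normed volume t * L := mul_nonneg (φ.nonneg_normed t) L.2
    rw [Real.coe_nnabs, abs_of_nonneg h0, dist_eq_norm, ← smul_sub, norm_smul,
      Real.norm_of_nonneg (φ.nonneg_normed t), mul_assoc]
    refine mul_le_mul_of_nonneg_left ?_ (φ.nonneg_normed t)
    rw [← dist_eq_norm]
    refine (hg.dist_le_mul _ _).trans_eq ?_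
    rw [dist_sub_right]
  · exact φ.integrable_normed.mul_const _
  -- Rademacher's theorem, transported by the measure-preserving reflection t ↦ x - t.
  · have h1 : ∀ᵐ t, DifferentiableAt ℝ g (x - t) :=
      (Measure.measurePreserving_sub_left volume x).quasiMeasurePreserving.ae hg.ae_differentiableAt
    filter_upwards [h1] with t ht
    have h2 : HasFDerivAt (fun y => g (y - t)) (fderiv ℝ g (x - t)) x := by
      exact ht.hasFDerivAt.comp x ((hasFDerivAt_id x).sub_const t)
    exact h2.const_smul (φ.normed volume t)

theorem norm_convolution_normed_le {F : Type*} [NormedAddCommGroup F] [NormedSpace ℝ F]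
    (φ : ContDiffBump (0 : E)) {f : E → F} {B : ℝ} (hB : ∀ x, ‖f x‖ ≤ B) (x : E) :
    ‖(φ.normed volume ⋆[ContinuousLinearMap.lsmul ℝ ℝ, volume] f) x‖ ≤ B := by
  have h : ∫ t, φ.normed volume t * B = B := by
    rw [integral_mul_const, φ.integral_normed, one_mul]
  rw [← h]
  refine norm_integral_le_of_norm_le (φ.integrable_normed.mul_const _)
    (Eventually.of_forall fun t => ?_)
  rw [ContinuousLinearMap.lsmul_apply, norm_smul, Real.norm_of_nonneg (φ.nonneg_normed t)]
  exact mul_le_mul_of_nonneg_left (hB _) (φ.nonneg_normed t)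

/-- A nonnegative compactly supported Lipschitz function is a limit of smooth ones, with
supports in a fixed compact set and with bounded gradients converging almost everywhere. -/
theorem exists_smooth_approx {g : E → ℝ} {L : ℝ≥0} (hg : LipschitzWith L g)
    (hc : HasCompactSupport g) (h0 : ∀ x, 0 ≤ g x) {O : Set E} (hO : IsOpen O)
    (hgO : tsupport g ⊆ O) :
    ∃ (G : ℕ → E → ℝ) (K : Set E) (B : ℝ), IsCompact K ∧ K ⊆ O ∧
      (∀ k, ContDiff ℝ ∞ (G k)) ∧ (∀ k x, 0 ≤ G k x) ∧ (∀ k x, G k x ≤ B) ∧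
      (∀ k, Function.support (G k) ⊆ K) ∧ (∀ k x, ‖fderiv ℝ (G k) x‖ ≤ L) ∧
      (∀ x, Tendsto (fun k => G k x) atTop (𝓝 (g x))) ∧
      (∀ᵐ x, Tendsto (fun k => fderiv ℝ (G k) x) atTop (𝓝 (fderiv ℝ g x))) := by
  obtain ⟨δ, hδ, hδO⟩ := hc.isCompact.exists_cthickening_subset_open hO hgO
  obtain ⟨B, hB⟩ := hc.exists_bound_of_continuous hg.continuous
  -- Outer radii at most δ keep the supports inside `O`; the fixed ratio 2 of the radii is what the
  -- Lebesgue differentiation theorem needs for the derivatives.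
  let φ : ℕ → ContDiffBump (0 : E) := fun k =>
    ⟨δ / (k + 1) / 2, δ / (k + 1), by positivity, half_lt_self (by positivity)⟩
  have hφ : Tendsto (fun k => (φ k).rOut) atTop (𝓝 0) := by
    have := tendsto_one_div_add_atTop_nhds_zero_nat (𝕜 := ℝ)
    simpa [φ, div_eq_mul_inv] using this.const_mul δ
  have hφ2 : ∀ᶠ k in atTop, (φ k).rOut ≤ 2 * (φ k).rIn := by
    refine Eventually.of_forall fun k => le_of_eq ?_
    simp only [φ]; ring
  have hφδ (k : ℕ) : (φ k).rOut ≤ δ := div_le_self hδ.le (by simp)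
  set G : ℕ → E → ℝ := fun k =>
    ((φ k).normed volume ⋆[ContinuousLinearMap.lsmul ℝ ℝ, volume] g)
  have hfd (k : ℕ) (x : E) : fderiv ℝ (G k) x =
      ((φ k).normed volume ⋆[ContinuousLinearMap.lsmul ℝ ℝ, volume] fderiv ℝ g) x :=
    (hasFDerivAt_convolution_of_lipschitz hg (φ k) x).fderiv
  have hbd (x : E) : ‖fderiv ℝ g x‖ ≤ L := norm_fderiv_le_of_lipschitz ℝ hg
  have hli : LocallyIntegrable (fderiv ℝ g) volume :=
    (locallyIntegrable_const (L : ℝ)).mono (measurable_fderiv ℝ g).aestronglyMeasurable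
      (Eventually.of_forall fun x => by simpa using hbd x)
  refine ⟨G, Metric.cthickening δ (tsupport g), B, hc.isCompact.cthickening, hδO, fun k => ?_,
    fun k x => ?_, fun k x => ?_, fun k => ?_, fun k x => ?_, fun x => ?_, ?_⟩
  · exact (φ k).hasCompactSupport_normed.contDiff_convolution_left _ (φ k).contDiff_normed
      hg.continuous.locallyIntegrable
  · exact integral_nonneg fun t => mul_nonneg ((φ k).nonneg_normed t) (h0 _)
  · exact (le_abs_self _).trans (norm_convolution_normed_le (φ k) hB x)
  · refine (support_convolution_subset _).trans ?_
    rintro x ⟨a, ha, b, hb, rfl⟩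
    rw [ContDiffBump.support_normed_eq, mem_ball_zero_iff] at ha
    refine Metric.mem_cthickening_of_dist_le _ b δ _ (subset_tsupport g hb) ?_
    simpa [dist_eq_norm] using ha.le.trans (hφδ k)
  · rw [hfd]
    exact norm_convolution_normed_le (φ k) hbd x
  · exact ContDiffBump.convolution_tendsto_right_of_continuous hφ hg.continuous x
  · simp_rw [hfd]
    exact ContDiffBump.ae_convolution_tendsto_right_of_locallyIntegrable hφ hφ2 hli

end Mollification

/-! ### Functions that are locally Lipschitz in charts. -/

section LipInCharts

variable {M : Type*} [TopologicalSpace M]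

/-- `f` is locally Lipschitz when read in the charts. -/
def LipInCharts (n : ℕ) {M : Type*} [TopologicalSpace M]
    [ChartedSpace (EuclideanSpace ℝ (Fin n)) M] (f : M → ℝ) : Prop :=
  ∀ (p : M), ∀ u ∈ (chartAt (EuclideanSpace ℝ (Fin n)) p).target,
    ∃ K, ∃ t ∈ 𝓝 u, LipschitzOnWith K (f ∘ (chartAt (EuclideanSpace ℝ (Fin n)) p).symm) t

variable {n : ℕ} [ChartedSpace (EuclideanSpace ℝ (Fin n)) M]

theorem LipInCharts.comp₂ {f g : M → ℝ} (hf : LipInCharts n f) (hg : LipInCharts n g)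
    {Φ : ℝ × ℝ → ℝ} (hΦ : ContDiff ℝ 1 Φ) : LipInCharts n fun x => Φ (f x, g x) := by
  intro p u hu
  obtain ⟨K₁, t₁, ht₁, h₁⟩ := hf p u hu
  obtain ⟨K₂, t₂, ht₂, h₂⟩ := hg p u hu
  set e := chartAt (EuclideanSpace ℝ (Fin n)) p
  obtain ⟨K, s, hs, h⟩ := hΦ.locallyLipschitz ((f ∘ e.symm) u, (g ∘ e.symm) u)
  have h12 := (h₁.mono (s := t₁ ∩ t₂) inter_subset_left).prodMk (h₂.mono inter_subset_right)
  have hc : ContinuousAt (fun v => ((f ∘ e.symm) v, (g ∘ e.symm) v)) u :=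
    h12.continuousOn.continuousAt (inter_mem ht₁ ht₂)
  refine ⟨K * max K₁ K₂, (t₁ ∩ t₂) ∩ _, inter_mem (inter_mem ht₁ ht₂) (hc.preimage_mem_nhds hs), ?_⟩
  exact h.comp (h12.mono inter_subset_left) fun v hv => hv.2

theorem LipInCharts.mul {f g : M → ℝ} (hf : LipInCharts n f) (hg : LipInCharts n g) :
    LipInCharts n fun x => f x * g x :=
  hf.comp₂ hg (Φ := fun z => z.1 * z.2) (contDiff_fst.mul contDiff_snd)

theorem lipInCharts_of_contMDiff [IsManifold (𝓡 n) ∞ M] {f : M → ℝ}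
    (hf : ContMDiff (𝓡 n) 𝓘(ℝ, ℝ) 1 f) : LipInCharts n f := by
  intro p u hu
  set e := chartAt (EuclideanSpace ℝ (Fin n)) p
  have h1 : ContMDiffOn (𝓡 n) (𝓡 n) ∞ e.symm e.target := contMDiffOn_chart_symm
  have h2 : ContMDiffOn (𝓡 n) 𝓘(ℝ, ℝ) 1 (f ∘ e.symm) e.target :=
    hf.comp_contMDiffOn (h1.of_le (by norm_cast))
  have h3 : ContDiffAt ℝ 1 (f ∘ e.symm) u :=
    (contMDiffOn_iff_contDiffOn.1 h2).contDiffAt (e.open_target.mem_nhds hu)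
  exact h3.exists_lipschitzOnWith

end LipInCharts

/-! ### Calculus of the gradient. -/

section Grad

variable {n : ℕ} {M : Type*} [TopologicalSpace M] [ChartedSpace (EuclideanSpace ℝ (Fin n)) M]
    [RiemannianBundle (fun x : M => TangentSpace (𝓡 n) x)]

theorem grad_congr {f g : M → ℝ} {x : M} (h : f =ᶠ[𝓝 x] g) :
    grad (n := n) f x = grad (n := n) g x := by
  refine ext_inner_right ℝ fun v => ?_
  rw [inner_grad, inner_grad]
  exact congrArg (fun T : EuclideanSpace ℝ (Fin n) →L[ℝ] ℝ => T v) (h.mfderiv_eq (I := 𝓡 n))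

theorem grad_const (c : ℝ) (x : M) : grad (n := n) (fun _ : M => c) x = 0 := by
  refine ext_inner_right ℝ fun v => ?_
  rw [inner_grad, inner_zero_left]
  exact congrArg (fun T : EuclideanSpace ℝ (Fin n) →L[ℝ] ℝ => T v)
    (mfderiv_const (I := 𝓡 n) (I' := 𝓘(ℝ, ℝ)) (c := c))

theorem grad_eq_zero_of_notMem_tsupport {f : M → ℝ} {x : M} (h : x ∉ tsupport f) :
    grad (n := n) f x = 0 := by
  rw [grad_congr (notMem_tsupport_iff_eventuallyEq.1 h)]
  exact grad_const 0 x

theorem grad_eq_of_hasMFDerivAt {f : M → ℝ} {x : M} {T : TangentSpace (𝓡 n) x →L[ℝ] ℝ}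
    (h : HasMFDerivAt (𝓡 n) 𝓘(ℝ, ℝ) f x T) {w : TangentSpace (𝓡 n) x}
    (hw : ∀ v, T v = inner ℝ w v) : grad (n := n) f x = w := by
  refine ext_inner_right ℝ fun v => ?_
  rw [inner_grad, h.mfderiv, ← hw v]
  rfl

theorem grad_mul {f g : M → ℝ} {x : M} (hf : MDifferentiableAt (𝓡 n) 𝓘(ℝ, ℝ) f x)
    (hg : MDifferentiableAt (𝓡 n) 𝓘(ℝ, ℝ) g x) :
    grad (n := n) (fun y => f y * g y) x = f x • grad (n := n) g x + g x • grad (n := n) f x := by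
  refine grad_eq_of_hasMFDerivAt (hf.hasMFDerivAt.mul hg.hasMFDerivAt) fun v => ?_
  rw [inner_add_left, inner_smul_left, inner_smul_left, inner_grad, inner_grad]
  rfl

theorem grad_comp {f : M → ℝ} {x : M} {h : ℝ → ℝ} {h' : ℝ} (hh : HasDerivAt h h' (f x))
    (hf : MDifferentiableAt (𝓡 n) 𝓘(ℝ, ℝ) f x) :
    grad (n := n) (fun y => h (f y)) x = h' • grad (n := n) f x := by
  refine grad_eq_of_hasMFDerivAt (HasMFDerivAt.comp x hh.hasFDerivAt.hasMFDerivAt hf.hasMFDerivAt)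
    fun v => ?_
  rw [inner_smul_left, inner_grad]
  exact mul_comm (G := ℝ) _ _

theorem grad_add {f g : M → ℝ} {x : M} (hf : MDifferentiableAt (𝓡 n) 𝓘(ℝ, ℝ) f x)
    (hg : MDifferentiableAt (𝓡 n) 𝓘(ℝ, ℝ) g x) :
    grad (n := n) (f + g) x = grad (n := n) f x + grad (n := n) g x := by
  refine grad_eq_of_hasMFDerivAt (hf.hasMFDerivAt.add hg.hasMFDerivAt) fun v => ?_
  rw [inner_add_left, inner_grad, inner_grad]
  rfl

theorem grad_sum {ι : Type*} (s : Finset ι) {f : ι → M → ℝ} {x : M}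
    (hf : ∀ i ∈ s, MDifferentiableAt (𝓡 n) 𝓘(ℝ, ℝ) (f i) x) :
    MDifferentiableAt (𝓡 n) 𝓘(ℝ, ℝ) (∑ i ∈ s, f i) x ∧
      grad (n := n) (∑ i ∈ s, f i) x = ∑ i ∈ s, grad (n := n) (f i) x := by
  classical
  induction s using Finset.induction_on with
  | empty =>
    rw [Finset.sum_empty, Finset.sum_empty]
    exact ⟨mdifferentiableAt_const, grad_const 0 x⟩
  | insert i s hi IH =>
    obtain ⟨h1, h2⟩ := IH fun j hj => hf j (Finset.mem_insert_of_mem hj)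
    have h3 := hf i (Finset.mem_insert_self i s)
    rw [Finset.sum_insert hi, Finset.sum_insert hi, grad_add h3 h1, h2]
    exact ⟨h3.add h1, rfl⟩

/-- Since the gradient defaults to 0, the eikonal equation |∇ρ| = 1 itself gives differentiability
of ρ almost everywhere. -/
theorem mdifferentiableAt_of_grad_ne_zero {f : M → ℝ} {x : M} (h : grad (n := n) f x ≠ 0) :
    MDifferentiableAt (𝓡 n) 𝓘(ℝ, ℝ) f x := by
  by_contra hf
  apply h
  refine ext_inner_right ℝ fun v => ?_
  rw [inner_grad, mfderiv_zero_of_not_mdifferentiableAt hf, inner_zero_left]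
  rfl

end Grad

/-! ### Lipschitz test functions supported in a chart. -/

section TestFunctions

variable {n : ℕ} {M : Type*} [TopologicalSpace M]
    [ChartedSpace (EuclideanSpace ℝ (Fin n)) M]

theorem partials_congr {f : M → ℝ} {p : M} {u : EuclideanSpace ℝ (Fin n)}
    {G : EuclideanSpace ℝ (Fin n) → ℝ}
    (h : f ∘ (chartAt (EuclideanSpace ℝ (Fin n)) p).symm =ᶠ[𝓝 u] G) (i : Fin n) :
    partials f p u i = fderiv ℝ G u (EuclideanSpace.single i 1) := by
  rw [partials, h.fderiv_eq]

/-- The function on `M` with expression `G` in the chart at `p`, extended by `0`. -/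
noncomputable def fromChart (p : M) (G : EuclideanSpace ℝ (Fin n) → ℝ) : M → ℝ :=
  (chartAt (EuclideanSpace ℝ (Fin n)) p).source.indicator
    (G ∘ chartAt (EuclideanSpace ℝ (Fin n)) p)

theorem fromChart_comp_symm_eventuallyEq {p : M} {G : EuclideanSpace ℝ (Fin n) → ℝ}
    {u : EuclideanSpace ℝ (Fin n)} (hu : u ∈ (chartAt (EuclideanSpace ℝ (Fin n)) p).target) :
    fromChart p G ∘ (chartAt (EuclideanSpace ℝ (Fin n)) p).symm =ᶠ[𝓝 u] G := by
  filter_upwards [(chartAt (EuclideanSpace ℝ (Fin n)) p).open_target.mem_nhds hu] with v hv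
  simp [fromChart, (chartAt (EuclideanSpace ℝ (Fin n)) p).map_target hv,
    (chartAt (EuclideanSpace ℝ (Fin n)) p).right_inv hv]

theorem support_fromChart_subset {p : M} {G : EuclideanSpace ℝ (Fin n) → ℝ}
    {K : Set (EuclideanSpace ℝ (Fin n))} (hG : Function.support G ⊆ K) :
    Function.support (fromChart p G) ⊆ (chartAt (EuclideanSpace ℝ (Fin n)) p).symm '' K := by
  intro x hx
  rw [fromChart, support_indicator] at hx
  exact ⟨_, hG hx.2, (chartAt (EuclideanSpace ℝ (Fin n)) p).left_inv hx.1⟩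

variable [IsManifold (𝓡 n) ∞ M]

theorem contMDiff_fromChart [T2Space M] {p : M} {G : EuclideanSpace ℝ (Fin n) → ℝ}
    (hGs : ContDiff ℝ ∞ G) {K : Set (EuclideanSpace ℝ (Fin n))} (hK : IsCompact K)
    (hKt : K ⊆ (chartAt (EuclideanSpace ℝ (Fin n)) p).target) (hG : Function.support G ⊆ K) :
    ContMDiff (𝓡 n) 𝓘(ℝ, ℝ) ∞ (fromChart p G) := by
  set e := chartAt (EuclideanSpace ℝ (Fin n)) p
  have hS : IsClosed (e.symm '' K) := (hK.image_of_continuousOn (e.continuousOn_symm.mono hKt)).isClosed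
  intro x
  by_cases hx : x ∈ e.source
  · have h1 : ContMDiffAt (𝓡 n) (𝓡 n) ∞ e x :=
      (contMDiffOn_chart (x := p)).contMDiffAt (e.open_source.mem_nhds hx)
    have h2 : ContMDiffAt (𝓡 n) 𝓘(ℝ, ℝ) ∞ (G ∘ e) x := hGs.contMDiff.contMDiffAt.comp x h1
    refine h2.congr_of_eventuallyEq ?_
    filter_upwards [e.open_source.mem_nhds hx] with y hy
    exact indicator_of_mem hy _
  · have hxS : x ∉ e.symm '' K := by
      rintro ⟨u, hu, rfl⟩
      exact hx (e.map_target (hKt hu))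
    refine (contMDiffAt_const (c := (0 : ℝ))).congr_of_eventuallyEq ?_
    filter_upwards [hS.isOpen_compl.mem_nhds hxS] with y hy
    by_contra h
    exact hy (support_fromChart_subset hG h)

variable [RiemannianBundle (fun x : M => TangentSpace (𝓡 n) x)]

/-- A crude bound, used to dominate the gradients of the mollified test functions and to see that a
vanishing coordinate derivative forces a vanishing gradient. -/
theorem norm_grad_sq_le (f : M → ℝ) {p : M} {u : EuclideanSpace ℝ (Fin n)}
    (hu : u ∈ (chartAt (EuclideanSpace ℝ (Fin n)) p).target) :
    ‖grad (n := n) f ((chartAt (EuclideanSpace ℝ (Fin n)) p).symm u)‖ ^ 2 ≤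
      ‖fderiv ℝ (f ∘ (chartAt (EuclideanSpace ℝ (Fin n)) p).symm) u‖ ^ 2 *
        ∑ i, ∑ j, |(gram p u)⁻¹ i j| := by
  rw [← real_inner_self_eq_norm_sq, inner_grad_grad f f hu]
  set F := ‖fderiv ℝ (f ∘ (chartAt (EuclideanSpace ℝ (Fin n)) p).symm) u‖
  have hF (i : Fin n) : |partials f p u i| ≤ F := by
    refine ((fderiv ℝ (f ∘ (chartAt (EuclideanSpace ℝ (Fin n)) p).symm) u).le_opNorm _).trans_eq ?_
    simp [F]
  simp only [dotProduct, Matrix.mulVec, Finset.mul_sum]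
  refine Finset.sum_le_sum fun i _ => Finset.sum_le_sum fun j _ => (le_abs_self _).trans ?_
  rw [abs_mul, abs_mul, sq]
  calc |partials f p u i| * (|(gram p u)⁻¹ i j| * |partials f p u j|)
      ≤ F * (|(gram p u)⁻¹ i j| * F) := by
        gcongr
        · exact hF i
        · exact hF j
    _ = _ := by ring

variable [MeasurableSpace M] [BorelSpace M] [SecondCountableTopology M] [T2Space M]
    [IsContMDiffRiemannianBundle (𝓡 n) ∞ (EuclideanSpace ℝ (Fin n))
      (fun x : M => TangentSpace (𝓡 n) x)]

/-- The inequality `Δ ρ ≥ C / ρ` may be tested on Lipschitz functions supported in a chart. -/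
theorem DistribLaplacianGe.lipschitz_test_of_subset_source {ρ : M → ℝ} {C : ℝ}
    (hΔ : DistribLaplacianGe n ρ C) (hρ : Continuous ρ)
    (hρ1 : ∀ᵐ x ∂(riemVolume n M), ‖grad (n := n) ρ x‖ ≤ 1)
    {ψ : M → ℝ} (hL : LipInCharts n ψ) (hc : HasCompactSupport ψ) (h0 : ∀ x, 0 ≤ ψ x)
    (hψρ : tsupport ψ ⊆ {x | ρ x ≠ 0}) {p : M}
    (hp : tsupport ψ ⊆ (chartAt (EuclideanSpace ℝ (Fin n)) p).source) :
    Integrable (fun x => C / ρ x * ψ x) (riemVolume n M) ∧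
    Integrable (fun x => inner ℝ (grad (n := n) ρ x) (grad (n := n) ψ x)) (riemVolume n M) ∧
    ∫ x, C / ρ x * ψ x ∂(riemVolume n M) ≤
      - ∫ x, inner ℝ (grad (n := n) ρ x) (grad (n := n) ψ x) ∂(riemVolume n M) := by
  set e := chartAt (EuclideanSpace ℝ (Fin n)) p with he
  -- `g` is ψ read in the chart; it is globally Lipschitz with compact support, hence can be
  -- mollified.
  set g : EuclideanSpace ℝ (Fin n) → ℝ := e.target.indicator (ψ ∘ e.symm) with hg
  have hKc : IsCompact (e '' tsupport ψ) :=
    hc.isCompact.image_of_continuousOn (e.continuousOn.mono hp)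
  have hgsupp : tsupport g ⊆ e '' tsupport ψ := by
    refine closure_minimal (fun u hu => ?_) hKc.isClosed
    rw [hg, support_indicator] at hu
    exact ⟨_, subset_tsupport ψ hu.2, e.right_inv hu.1⟩
  have hgc : HasCompactSupport g := hKc.of_isClosed_subset (isClosed_tsupport g) hgsupp
  have hgt : tsupport g ⊆ e.target := hgsupp.trans (by
    rintro _ ⟨x, hx, rfl⟩; exact e.map_source (hp hx))
  have hg0 (u) : 0 ≤ g u := indicator_nonneg (fun v _ => h0 _) u
  have hgψ {u} (hu : u ∈ e.target) : ψ ∘ e.symm =ᶠ[𝓝 u] g := by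
    filter_upwards [e.open_target.mem_nhds hu] with v hv
    rw [hg, indicator_of_mem hv]
  obtain ⟨L, hgL⟩ := exists_lipschitzWith_of_hasCompactSupport hgc fun u hu => by
    obtain ⟨K, t, ht, h⟩ := hL p u (hgt hu)
    refine ⟨K, t ∩ e.target, inter_mem ht (e.open_target.mem_nhds (hgt hu)), ?_⟩
    intro x hx y hy
    rw [hg, indicator_of_mem hx.2, indicator_of_mem hy.2]
    exact h hx.1 hy.1
  obtain ⟨G, K, B, hK, hKO, hGs, hG0, hGB, hGK, hGL, hGt, hGd⟩ := exists_smooth_approx hgL hgc hg0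
    -- This choice of open set keeps the mollified functions supported in the chart and away from
    -- the zeros of ρ, hence admissible.
    (O := e.target ∩ e.symm ⁻¹' (ρ ⁻¹' {y | y ≠ 0}))
    (e.isOpen_inter_preimage_symm (hρ.isOpen_preimage _ isOpen_ne))
    (fun u hu => ⟨hgt hu, by
      obtain ⟨x, hx, rfl⟩ := hgsupp hu
      rw [mem_preimage, e.left_inv (hp hx)]
      exact hψρ hx⟩)
  have hKt : K ⊆ e.target := fun u hu => (hKO hu).1
  set S := e.symm '' K with hSdef
  have hS : IsCompact S := hK.image_of_continuousOn (e.continuousOn_symm.mono hKt)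
  have hSρ : S ⊆ {x | ρ x ≠ 0} := by
    rintro _ ⟨u, hu, rfl⟩; exact (hKO hu).2
  set Ψ : ℕ → M → ℝ := fun k => fromChart p (G k) with hΨ
  have hΨS (k) : tsupport (Ψ k) ⊆ S :=
    closure_minimal (support_fromChart_subset (hGK k)) hS.isClosed
  have hΨc (k) : HasCompactSupport (Ψ k) := hS.of_isClosed_subset (isClosed_tsupport _) (hΨS k)
  have hΨ0 (k x) : 0 ≤ Ψ k x := indicator_nonneg (fun v _ => hG0 k _) x
  have hΨB (k x) : Ψ k x ≤ B := by
    refine indicator_le' (fun y _ => hGB k _) (fun y _ => ?_) x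
    exact (hG0 k (e y)).trans (hGB k _)
  have hΨt (x) : Tendsto (fun k => Ψ k x) atTop (𝓝 (ψ x)) := by
    by_cases hx : x ∈ e.source
    · have h1 : g (e x) = ψ x := by
        rw [hg, indicator_of_mem (e.map_source hx), Function.comp, e.left_inv hx]
      simp only [hΨ, fromChart, ← he, indicator_of_mem hx, Function.comp, ← h1]
      exact hGt (e x)
    · have h1 : ψ x = 0 := image_eq_zero_of_notMem_tsupport fun h => hx (hp h)
      simp only [hΨ, fromChart, ← he, indicator_of_notMem hx, h1]
      exact tendsto_const_nhds
  have htest (k) := hΔ (Ψ k) (contMDiff_fromChart (hGs k) hK hKt (hGK k)) (hΨc k)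
    ((hΨS k).trans hSρ) (hΨ0 k)
  have hSfin : riemVolume n M S < ⊤ := hS.measure_lt_top
  have hSm : MeasurableSet S := hS.isClosed.measurableSet
  -- convergence of the left-hand sides
  obtain ⟨c, hcb⟩ := hS.exists_bound_of_continuousOn (f := fun x => C / ρ x)
    (continuousOn_const.div hρ.continuousOn hSρ)
  have hbl (k x) : ‖C / ρ x * Ψ k x‖ ≤ S.indicator (fun _ => c * B) x := by
    by_cases hx : x ∈ S
    · rw [indicator_of_mem hx, norm_mul, Real.norm_of_nonneg (hΨ0 k x)]
      exact mul_le_mul (hcb x hx) (hΨB k x) (hΨ0 k x) ((norm_nonneg _).trans (hcb x hx))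
    · rw [indicator_of_notMem hx, image_eq_zero_of_notMem_tsupport fun h => hx (hΨS k h)]
      simp
  have hil (c' : ℝ) : Integrable (S.indicator fun _ => c') (riemVolume n M) :=
    (integrable_indicator_iff hSm).2 (integrableOn_const hSfin.ne)
  have hml (k) : AEStronglyMeasurable (fun x => C / ρ x * Ψ k x) (riemVolume n M) :=
    ((measurable_const.div hρ.measurable).mul
      (contMDiff_fromChart (hGs k) hK hKt (hGK k)).continuous.measurable).aestronglyMeasurable
  have hlt (x) : Tendsto (fun k => C / ρ x * Ψ k x) atTop (𝓝 (C / ρ x * ψ x)) :=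
    (hΨt x).const_mul _
  have hlim1 := tendsto_integral_of_dominated_convergence _ hml (hil (c * B))
    (fun k => Eventually.of_forall (hbl k)) (Eventually.of_forall hlt)
  -- convergence of the right-hand sides
  obtain ⟨d, hd⟩ := hK.exists_bound_of_continuousOn
    (f := fun u => ∑ i, ∑ j, |(gram p u)⁻¹ i j|)
    (continuousOn_finsetSum _ fun i _ => continuousOn_finsetSum _ fun j _ u hu =>
      (continuous_abs.tendsto _).comp (((continuous_apply_apply i j).tendsto _).comp
        ((continuousOn_gram_inv p).mono hKt u hu)))
  have hgradS (k) {x} (hx : x ∉ S) : grad (n := n) (Ψ k) x = 0 :=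
    grad_eq_zero_of_notMem_tsupport fun h => hx (hΨS k h)
  have hgradB (k) {x} (hx : x ∈ S) : ‖grad (n := n) (Ψ k) x‖ ≤ Real.sqrt ((L : ℝ) ^ 2 * d) := by
    obtain ⟨u, hu, rfl⟩ := hx
    refine Real.le_sqrt_of_sq_le ((norm_grad_sq_le (Ψ k) (hKt hu)).trans ?_)
    rw [(fromChart_comp_symm_eventuallyEq (hKt hu)).fderiv_eq]
    have hd' := (le_abs_self _).trans (hd u hu)
    have := hGL k u
    gcongr
  have hbr (k) : ∀ᵐ x ∂(riemVolume n M),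
      ‖inner ℝ (grad (n := n) ρ x) (grad (n := n) (Ψ k) x)‖ ≤
        S.indicator (fun _ => Real.sqrt ((L : ℝ) ^ 2 * d)) x := by
    filter_upwards [hρ1] with x hx
    by_cases hxS : x ∈ S
    · rw [indicator_of_mem hxS]
      refine (norm_inner_le_norm _ _).trans ?_
      calc _ ≤ 1 * ‖grad (n := n) (Ψ k) x‖ := by gcongr
        _ ≤ _ := by rw [one_mul]; exact hgradB k hxS
    · rw [indicator_of_notMem hxS, hgradS k hxS, inner_zero_right, norm_zero]
  have hmr (k) : AEStronglyMeasurable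
      (fun x => inner ℝ (grad (n := n) ρ x) (grad (n := n) (Ψ k) x)) (riemVolume n M) :=
    (aemeasurable_inner_grad _ _).aestronglyMeasurable
  have hrt : ∀ᵐ x ∂(riemVolume n M),
      Tendsto (fun k => inner ℝ (grad (n := n) ρ x) (grad (n := n) (Ψ k) x)) atTop
        (𝓝 (inner ℝ (grad (n := n) ρ x) (grad (n := n) ψ x))) := by
    -- Only the coordinate derivatives of the test functions vary with `k`; they converge almost
    -- everywhere in the chart, hence almost everywhere on its domain.
    filter_upwards [ae_riemVolume_of_ae_chart p hGd] with x hx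
    by_cases hxs : x ∈ e.source
    · have hu := e.map_source hxs
      have hlim := hx hxs
      rw [← he] at hlim
      have e1 (f : M → ℝ) := inner_grad_grad (n := n) ρ f hu
      rw [← he, e.left_inv hxs] at e1
      simp only [e1, dotProduct, Matrix.mulVec]
      refine tendsto_finsetSum _ fun i _ => (tendsto_finsetSum _ fun j _ => ?_).const_mul _
      refine Tendsto.const_mul _ ?_
      simp only [partials_congr (hgψ hu) j, hΨ,
        fun k => partials_congr (fromChart_comp_symm_eventuallyEq (G := G k) hu) j]
      exact ((ContinuousLinearMap.apply ℝ ℝ (EuclideanSpace.single j (1 : ℝ))).continuous.tendsto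
        _).comp hlim
    · have h1 : x ∉ S := by
        rintro ⟨u, hu, rfl⟩; exact hxs (e.map_target (hKt hu))
      have h2 : grad (n := n) ψ x = 0 := grad_eq_zero_of_notMem_tsupport fun h => hxs (hp h)
      simp only [hgradS _ h1, h2]
      exact tendsto_const_nhds
  have hlim2 := tendsto_integral_of_dominated_convergence _ hmr (hil _) hbr hrt
  refine ⟨?_, ?_, le_of_tendsto_of_tendsto' hlim1 hlim2.neg htest⟩
  · refine (hil (c * B)).mono' (aestronglyMeasurable_of_tendsto_ae atTop hml
      (Eventually.of_forall hlt)) (Eventually.of_forall fun x => ?_)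
    exact le_of_tendsto' (hlt x).norm fun k => hbl k x
  · refine (hil (Real.sqrt ((L : ℝ) ^ 2 * d))).mono'
      (aemeasurable_inner_grad _ _).aestronglyMeasurable ?_
    filter_upwards [hrt, ae_all_iff.2 hbr] with x hx1 hx2
    exact le_of_tendsto' hx1.norm hx2

end TestFunctions

/-- A nonnegative locally Lipschitz function with `|∇ρ| = 1` almost everywhere and
`Δ ρ ≥ C / ρ` in the sense of distributions. -/
structure HardyWeight (n : ℕ) {M : Type*} [TopologicalSpace M] [MeasurableSpace M]
    [ChartedSpace (EuclideanSpace ℝ (Fin n)) M]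
    [RiemannianBundle (fun x : M => TangentSpace (𝓡 n) x)] (ρ : M → ℝ) (C : ℝ) : Prop where
  nonneg : ∀ x, 0 ≤ ρ x
  continuous : Continuous ρ
  lip : LipInCharts n ρ
  eikonal : ∀ᵐ x ∂(riemVolume n M), ‖grad (n := n) ρ x‖ = 1
  laplacian : DistribLaplacianGe n ρ C

/-! ### Almost everywhere properties of ρ, and general Lipschitz test functions. -/

section TestFunctions

variable {n : ℕ} {M : Type*} [TopologicalSpace M]
    [ChartedSpace (EuclideanSpace ℝ (Fin n)) M]

theorem continuousOn_partials [IsManifold (𝓡 n) ∞ M] {f : M → ℝ} (hf : ContMDiff (𝓡 n) 𝓘(ℝ, ℝ) 1 f) (p : M) (i : Fin n) :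
    ContinuousOn (fun u => partials f p u i) (chartAt (EuclideanSpace ℝ (Fin n)) p).target := by
  set e := chartAt (EuclideanSpace ℝ (Fin n)) p
  have h1 : ContMDiffOn (𝓡 n) (𝓡 n) ∞ e.symm e.target := contMDiffOn_chart_symm
  have h2 : ContMDiffOn (𝓡 n) 𝓘(ℝ, ℝ) 1 (f ∘ e.symm) e.target :=
    hf.comp_contMDiffOn (h1.of_le (by norm_cast))
  exact ((contMDiffOn_iff_contDiffOn.1 h2).continuousOn_fderiv_of_isOpen e.open_target
    le_rfl).clm_apply continuousOn_const

variable [RiemannianBundle (fun x : M => TangentSpace (𝓡 n) x)]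

theorem HardyWeight.ae_mdifferentiableAt [MeasurableSpace M] {ρ : M → ℝ} {C : ℝ} (h : HardyWeight n ρ C) :
    ∀ᵐ x ∂(riemVolume n M), MDifferentiableAt (𝓡 n) 𝓘(ℝ, ℝ) ρ x := by
  filter_upwards [h.eikonal] with x hx
  refine mdifferentiableAt_of_grad_ne_zero fun h0 => ?_
  rw [h0, norm_zero] at hx
  exact zero_ne_one hx

variable [IsManifold (𝓡 n) ∞ M]

theorem grad_eq_zero_of_isLocalMin {f : M → ℝ} {x : M} (h : IsLocalMin f x) :
    grad (n := n) f x = 0 := by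
  set e := chartAt (EuclideanSpace ℝ (Fin n)) x
  have hu : e x ∈ e.target := e.map_source (mem_chart_source _ x)
  have hx : e.symm (e x) = x := e.left_inv (mem_chart_source _ x)
  have h1 : IsLocalMin (f ∘ e.symm) (e x) := by
    have hc := e.continuousAt_symm hu
    rw [ContinuousAt, hx] at hc
    refine IsMinFilter.comp_tendsto (l := 𝓝 x) ?_ hc
    rw [hx]
    exact h
  have h2 := norm_grad_sq_le (n := n) f hu
  rw [h1.fderiv_eq_zero, norm_zero] at h2
  change ‖grad (n := n) f (e.symm (e x))‖ ^ 2 ≤ _ at h2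
  rw [hx] at h2
  have h3 : ‖grad (n := n) f x‖ ^ 2 ≤ 0 := by simpa using h2
  exact norm_eq_zero.1 (pow_eq_zero_iff two_ne_zero |>.1 (le_antisymm h3 (sq_nonneg _)))

/-- A zero of ρ ≥ 0 is a minimum, where the gradient vanishes, against |∇ρ| = 1. So the zero set is
null, and the values of negative powers of ρ at 0 do not matter. -/
theorem HardyWeight.ae_pos [MeasurableSpace M] {ρ : M → ℝ} {C : ℝ} (h : HardyWeight n ρ C) :
    ∀ᵐ x ∂(riemVolume n M), 0 < ρ x := by
  filter_upwards [h.eikonal] with x hx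
  refine (h.nonneg x).lt_of_ne fun h0 => ?_
  have : IsLocalMin ρ x := Eventually.of_forall fun y => by rw [← h0]; exact h.nonneg y
  rw [grad_eq_zero_of_isLocalMin this, norm_zero] at hx
  exact zero_ne_one hx

variable [IsContMDiffRiemannianBundle (𝓡 n) ∞ (EuclideanSpace ℝ (Fin n))
      (fun x : M => TangentSpace (𝓡 n) x)]

theorem continuous_norm_grad {f : M → ℝ} (hf : ContMDiff (𝓡 n) 𝓘(ℝ, ℝ) 1 f) :
    Continuous fun x => ‖grad (n := n) f x‖ := by
  refine continuous_iff_continuousAt.2 fun x => ?_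
  set e := chartAt (EuclideanSpace ℝ (Fin n)) x with he
  have hx := mem_chart_source (EuclideanSpace ℝ (Fin n)) x
  have h1 : ContinuousOn (fun u => Real.sqrt (∑ i, partials f x u i *
      ∑ j, (gram x u)⁻¹ i j * partials f x u j)) e.target := by
    refine Real.continuous_sqrt.comp_continuousOn ?_
    refine continuousOn_finsetSum _ fun i _ => (continuousOn_partials hf x i).mul
      (continuousOn_finsetSum _ fun j _ => ContinuousOn.mul ?_ (continuousOn_partials hf x j))
    exact fun u hu => ((continuous_apply_apply i j).tendsto _).comp (continuousOn_gram_inv x u hu)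
  have h2 := (h1.comp e.continuousOn fun y hy => e.map_source hy).continuousAt
    (e.open_source.mem_nhds hx)
  refine h2.congr ?_
  filter_upwards [e.open_source.mem_nhds hx] with y hy
  have := inner_grad_grad (n := n) f f (e.map_source hy)
  rw [← he, e.left_inv hy] at this
  rw [norm_eq_sqrt_real_inner, this]
  rfl

variable [MeasurableSpace M] [BorelSpace M] [SecondCountableTopology M] [T2Space M]

/-- The inequality `Δ ρ ≥ C / ρ` may be tested on Lipschitz functions. -/
theorem HardyWeight.lipschitz_test {ρ : M → ℝ} {C : ℝ} (hρ : HardyWeight n ρ C)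
    {ψ : M → ℝ} (hL : LipInCharts n ψ) (hc : HasCompactSupport ψ) (h0 : ∀ x, 0 ≤ ψ x)
    (hψρ : tsupport ψ ⊆ {x | ρ x ≠ 0})
    (hψd : ∀ᵐ x ∂(riemVolume n M), MDifferentiableAt (𝓡 n) 𝓘(ℝ, ℝ) ψ x) :
    Integrable (fun x => C / ρ x * ψ x) (riemVolume n M) ∧
    Integrable (fun x => inner ℝ (grad (n := n) ρ x) (grad (n := n) ψ x)) (riemVolume n M) ∧
    ∫ x, C / ρ x * ψ x ∂(riemVolume n M) ≤
      - ∫ x, inner ℝ (grad (n := n) ρ x) (grad (n := n) ψ x) ∂(riemVolume n M) := by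
  have : LocallyCompactSpace M := ChartedSpace.locallyCompactSpace (EuclideanSpace ℝ (Fin n)) M
  obtain ⟨f, hf⟩ := SmoothPartitionOfUnity.exists_isSubordinate_chartAt_source (𝓡 n) M
  -- Local finiteness of the partition leaves finitely many terms on the compact support of ψ, so
  -- the chart inequalities can be summed.
  have hfin : {i | (Function.support (f i) ∩ tsupport ψ).Nonempty}.Finite :=
    f.locallyFinite.finite_nonempty_inter_compact hc.isCompact
  set F := hfin.toFinset with hF
  have hsum (x : M) : ∑ i ∈ F, f i x * ψ x = ψ x := by
    rw [← Finset.sum_mul]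
    by_cases hx : x ∈ tsupport ψ
    · rw [← finsum_eq_sum_of_support_subset, f.sum_eq_one (mem_univ x), one_mul]
      intro i hi
      rw [hF, Finite.coe_toFinset]
      exact ⟨x, hi, hx⟩
    · rw [image_eq_zero_of_notMem_tsupport hx, mul_zero]
  have hsum' : ∑ i ∈ F, (fun x => f i x * ψ x) = ψ := by
    ext x
    rw [Finset.sum_apply, hsum]
  have hsub (i : M) : tsupport (fun x => f i x * ψ x) ⊆ tsupport ψ := tsupport_mul_subset_right
  have key (i : M) := hρ.laplacian.lipschitz_test_of_subset_source hρ.continuous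
    (hρ.eikonal.mono fun x hx => hx.le)
    (ψ := fun x => f i x * ψ x)
    ((lipInCharts_of_contMDiff ((f i).contMDiff.of_le (by norm_cast))).mul hL)
    (hc.of_isClosed_subset (isClosed_tsupport _) (hsub i))
    (fun x => mul_nonneg (f.nonneg i x) (h0 x)) ((hsub i).trans hψρ) (p := i)
    (tsupport_mul_subset_left.trans (hf i))
  have e1 : (fun x => C / ρ x * ψ x) = fun x => ∑ i ∈ F, C / ρ x * (f i x * ψ x) := by
    ext x
    rw [← Finset.mul_sum, hsum]
  have e2 : (fun x => inner ℝ (grad (n := n) ρ x) (grad (n := n) ψ x)) =ᵐ[riemVolume n M]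
      fun x => ∑ i ∈ F, inner ℝ (grad (n := n) ρ x) (grad (n := n) (fun x => f i x * ψ x) x) := by
    -- Splitting the gradient of the sum requires ψ to be differentiable at `x`.
    filter_upwards [hψd] with x hx
    rw [← inner_sum, ← (grad_sum (n := n) F fun i _ => ?_).2, hsum']
    exact ((f i).contMDiff.mdifferentiable (by simp) x).mul hx
  have i1 := integrable_finsetSum F fun i _ => (key i).1
  have i2 := integrable_finsetSum F fun i _ => (key i).2.1
  refine ⟨by rw [e1]; exact i1, i2.congr e2.symm, ?_⟩
  rw [e1, integral_congr_ae e2, integral_finsetSum F fun i _ => (key i).1,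
    integral_finsetSum F fun i _ => (key i).2.1, ← Finset.sum_neg_distrib]
  exact Finset.sum_le_sum fun i _ => (key i).2.2

end TestFunctions

/-! ### Powers cut off near zero. -/

section Cutoff

/-- A smooth function of `t` that vanishes for `t ≤ 1 / k` and is `t ^ γ` for `t ≥ 2 / k`. -/
noncomputable def cutPow (k : ℕ) (γ t : ℝ) : ℝ := t ^ γ * Real.smoothTransition (k * t - 1)

theorem cutPow_of_le {k : ℕ} (hk : 0 < k) (γ : ℝ) {t : ℝ} (ht : t ≤ 1 / k) : cutPow k γ t = 0 := by
  have hk' : (0 : ℝ) < k := by exact_mod_cast hk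
  rw [cutPow, Real.smoothTransition.zero_of_nonpos, mul_zero]
  rw [le_div_iff₀ hk'] at ht
  linarith

theorem cutPow_eventuallyEq_zero {k : ℕ} (hk : 0 < k) (γ : ℝ) {t : ℝ} (ht : t ≤ 0) :
    cutPow k γ =ᶠ[𝓝 t] fun _ => 0 := by
  have hk' : (0 : ℝ) < 1 / k := by positivity
  filter_upwards [Iio_mem_nhds (ht.trans_lt hk')] with s hs
  exact cutPow_of_le hk γ hs.le

theorem contDiff_cutPow {k : ℕ} (hk : 0 < k) (γ : ℝ) : ContDiff ℝ 1 (cutPow k γ) := by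
  refine contDiff_iff_contDiffAt.2 fun t => ?_
  rcases le_or_gt t 0 with ht | ht
  · exact contDiffAt_const.congr_of_eventuallyEq (cutPow_eventuallyEq_zero hk γ ht)
  · refine (Real.contDiffAt_rpow_const_of_ne ht.ne').mul ?_
    exact (Real.smoothTransition.contDiff (n := 1)).contDiffAt.comp t
      ((contDiffAt_const.mul contDiffAt_id).sub contDiffAt_const)

theorem cutPow_nonneg (k : ℕ) (γ : ℝ) {t : ℝ} (ht : 0 ≤ t) : 0 ≤ cutPow k γ t :=
  mul_nonneg (Real.rpow_nonneg ht γ) (Real.smoothTransition.nonneg _)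

theorem cutPow_le (k : ℕ) (γ : ℝ) {t : ℝ} (ht : 0 ≤ t) : cutPow k γ t ≤ t ^ γ :=
  mul_le_of_le_one_right (Real.rpow_nonneg ht γ) (Real.smoothTransition.le_one _)

theorem cutPow_add_one (k : ℕ) (γ : ℝ) {t : ℝ} (ht : 0 < t) :
    cutPow k (γ + 1) t = t * cutPow k γ t := by
  rw [cutPow, cutPow, Real.rpow_add_one ht.ne']; ring

/-- The cutoff factor is nondecreasing, so the extra term of the product rule is nonnegative and may
be dropped; this is why no estimate on the derivative of the cutoff is needed. -/
theorem le_deriv_cutPow {k : ℕ} (hk : 0 < k) (γ : ℝ) {t : ℝ} (ht : 0 ≤ t) :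
    (γ + 1) * cutPow k γ t ≤ deriv (cutPow k (γ + 1)) t := by
  rcases ht.eq_or_lt with rfl | ht
  · rw [(cutPow_eventuallyEq_zero hk (γ + 1) le_rfl).deriv_eq, cutPow_of_le hk γ (by positivity)]
    simp
  · have h1 : HasDerivAt (fun t : ℝ => t ^ (γ + 1)) ((γ + 1) * t ^ γ) t := by
      simpa using Real.hasDerivAt_rpow_const (x := t) (p := γ + 1) (Or.inl ht.ne')
    have h2 : DifferentiableAt ℝ (fun t : ℝ => Real.smoothTransition (k * t - 1)) t :=
      ((Real.smoothTransition.contDiff (n := 1)).differentiable one_ne_zero _).comp t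
        ((differentiableAt_id.const_mul _).sub_const 1)
    have hmono : Monotone fun t : ℝ => Real.smoothTransition (k * t - 1) := fun a b hab =>
      Real.smoothTransition.monotone (by gcongr)
    have h3 := (h1.mul h2.hasDerivAt).deriv
    have h4 : 0 ≤ deriv (fun t : ℝ => Real.smoothTransition (k * t - 1)) t := hmono.deriv_nonneg
    have h5 : deriv (cutPow k (γ + 1)) t = _ := h3
    rw [h5, cutPow]
    have := mul_nonneg (Real.rpow_nonneg ht.le (γ + 1)) h4
    nlinarith

theorem tendsto_cutPow (γ : ℝ) {t : ℝ} (ht : 0 < t) :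
    Tendsto (fun k : ℕ => cutPow k γ t) atTop (𝓝 (t ^ γ)) := by
  refine tendsto_const_nhds.congr' ?_
  filter_upwards [eventually_ge_atTop ⌈2 / t⌉₊] with k hk
  have : 2 / t ≤ k := (Nat.le_ceil _).trans (by exact_mod_cast hk)
  rw [div_le_iff₀ ht] at this
  rw [cutPow, Real.smoothTransition.one_of_one_le (by linarith), mul_one]

end Cutoff

/-! ### The divergence inequality for powers of ρ. -/

section WeightedInequality

theorem exists_bump_of_isCompact (n : ℕ) {M : Type*} [TopologicalSpace M] [T2Space M]
    [SecondCountableTopology M] [ChartedSpace (EuclideanSpace ℝ (Fin n)) M]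
    [IsManifold (𝓡 n) ∞ M] {K : Set M} (hK : IsCompact K) :
    ∃ u : M → ℝ, ContMDiff (𝓡 n) 𝓘(ℝ, ℝ) 1 u ∧ HasCompactSupport u ∧ (∀ x, 0 ≤ u x) ∧
      ∀ x ∈ K, u x = 1 := by
  have : LocallyCompactSpace M := ChartedSpace.locallyCompactSpace (EuclideanSpace ℝ (Fin n)) M
  obtain ⟨K', hK', hKK'⟩ := exists_compact_superset hK
  obtain ⟨f, hf0, hf1, hf⟩ := exists_contMDiffMap_zero_one_of_isClosed (𝓡 n) (n := 1)
    isOpen_interior.isClosed_compl hK.isClosed (s := (interior K')ᶜ) (t := K)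
    (disjoint_compl_left_iff_subset.2 hKK')
  refine ⟨f, f.contMDiff, HasCompactSupport.intro hK' fun x hx => ?_, fun x => (hf x).1,
    fun x hx => hf1 hx⟩
  exact hf0 fun h => hx (interior_subset h)

variable {n : ℕ} {M : Type*} [TopologicalSpace M]
    [ChartedSpace (EuclideanSpace ℝ (Fin n)) M]
    [RiemannianBundle (fun x : M => TangentSpace (𝓡 n) x)]

theorem hasCompactSupport_norm_grad [T2Space M] {u : M → ℝ} (huc : HasCompactSupport u) :
    HasCompactSupport fun x => ‖grad (n := n) u x‖ := by
  refine HasCompactSupport.intro huc.isCompact fun x hx => ?_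
  rw [grad_eq_zero_of_notMem_tsupport hx, norm_zero]

theorem HardyWeight.ae_abs_inner_grad_le [MeasurableSpace M] {ρ : M → ℝ} {C : ℝ}
    (hρ : HardyWeight n ρ C) (u : M → ℝ) :
    ∀ᵐ x ∂(riemVolume n M),
      |inner ℝ (grad (n := n) ρ x) (grad (n := n) u x)| ≤ ‖grad (n := n) u x‖ := by
  filter_upwards [hρ.eikonal] with x hx
  refine (abs_real_inner_le_norm _ _).trans_eq ?_
  rw [hx, one_mul]

variable [IsManifold (𝓡 n) ∞ M]
    [IsContMDiffRiemannianBundle (𝓡 n) ∞ (EuclideanSpace ℝ (Fin n))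
      (fun x : M => TangentSpace (𝓡 n) x)]
    [MeasurableSpace M] [BorelSpace M] [SecondCountableTopology M] [T2Space M]
    {ρ : M → ℝ} {C : ℝ}

/-- Test Δρ ≥ C/ρ on h(ρ) u, where h = `cutPow k (γ + 1)`. By the eikonal equation, ⟨∇ρ, ∇(h(ρ) u)⟩
= h(ρ) ⟨∇ρ, ∇u⟩ + h'(ρ) u, and h'(ρ) ≥ (γ + 1) `cutPow k γ` ρ. -/
theorem HardyWeight.cutoff_inequality (hρ : HardyWeight n ρ C) {k : ℕ} (hk : 0 < k)
    (γ : ℝ) {u : M → ℝ} (hu : ContMDiff (𝓡 n) 𝓘(ℝ, ℝ) 1 u) (huc : HasCompactSupport u)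
    (hu0 : ∀ x, 0 ≤ u x) :
    Integrable (fun x => cutPow k γ (ρ x) * u x) (riemVolume n M) ∧
    Integrable (fun x => cutPow k (γ + 1) (ρ x) *
      inner ℝ (grad (n := n) ρ x) (grad (n := n) u x)) (riemVolume n M) ∧
    (C + γ + 1) * ∫ x, cutPow k γ (ρ x) * u x ∂(riemVolume n M) ≤
      - ∫ x, cutPow k (γ + 1) (ρ x) *
        inner ℝ (grad (n := n) ρ x) (grad (n := n) u x) ∂(riemVolume n M) := by
  have hh := contDiff_cutPow hk (γ + 1)
  have hui : ∀ {h : ℝ → ℝ}, Continuous h →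
      Integrable (fun x => h (ρ x) * u x) (riemVolume n M) := fun hc =>
    ((hc.comp hρ.continuous).mul hu.continuous).integrable_of_hasCompactSupport huc.mul_left
  have i1 := hui (contDiff_cutPow hk γ).continuous
  have i2 := hui (hh.continuous_deriv le_rfl)
  have i3 : Integrable (fun x => cutPow k (γ + 1) (ρ x) *
      inner ℝ (grad (n := n) ρ x) (grad (n := n) u x)) (riemVolume n M) := by
    refine Integrable.mono' (g := fun x => cutPow k (γ + 1) (ρ x) * ‖grad (n := n) u x‖)
      (((hh.continuous.comp hρ.continuous).mul
        (continuous_norm_grad hu)).integrable_of_hasCompactSupport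
          (hasCompactSupport_norm_grad huc).mul_left)
      ((hh.continuous.comp hρ.continuous).aemeasurable.mul
        (aemeasurable_inner_grad _ _)).aestronglyMeasurable ?_
    filter_upwards [hρ.ae_abs_inner_grad_le u] with x hx
    have h0 := cutPow_nonneg k (γ + 1) (hρ.nonneg x)
    rw [norm_mul, Real.norm_of_nonneg h0]
    exact mul_le_mul_of_nonneg_left hx h0
  set ψ : M → ℝ := fun x => cutPow k (γ + 1) (ρ x) * u x with hψ
  have hψL : LipInCharts n ψ := hρ.lip.comp₂ (lipInCharts_of_contMDiff hu)
    (Φ := fun z => cutPow k (γ + 1) z.1 * z.2) ((hh.comp contDiff_fst).mul contDiff_snd)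
  have hψρ : tsupport ψ ⊆ {x | ρ x ≠ 0} := by
    -- The cutoff vanishes where ρ ≤ 1/k, so ψ is supported away from the zero set.
    have h1 : tsupport ψ ⊆ ρ ⁻¹' Ici (1 / k) := by
      refine closure_minimal (fun x hx => ?_) (isClosed_Ici.preimage hρ.continuous)
      by_contra h
      refine hx ?_
      rw [hψ]
      simp only
      rw [cutPow_of_le hk _ (not_le.1 h).le, zero_mul]
    intro x hx
    have hk' : (0 : ℝ) < 1 / k := by positivity
    exact (hk'.trans_le (h1 hx)).ne'
  have hud : ∀ x, MDifferentiableAt (𝓡 n) 𝓘(ℝ, ℝ) u x := fun x => hu.mdifferentiable one_ne_zero x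
  have hcd : ∀ x, MDifferentiableAt (𝓡 n) 𝓘(ℝ, ℝ) ρ x →
      MDifferentiableAt (𝓡 n) 𝓘(ℝ, ℝ) (fun y => cutPow k (γ + 1) (ρ y)) x := fun x hx =>
    ((hh.differentiable one_ne_zero).differentiableAt.mdifferentiableAt).comp x hx
  obtain ⟨j1, j2, j3⟩ := hρ.lipschitz_test hψL huc.mul_left
    (fun x => mul_nonneg (cutPow_nonneg _ _ (hρ.nonneg x)) (hu0 x)) hψρ
    (hρ.ae_mdifferentiableAt.mono fun x hx => (hcd x hx).mul (hud x))
  have e2 : (fun x => inner ℝ (grad (n := n) ρ x) (grad (n := n) ψ x)) =ᵐ[riemVolume n M]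
      fun x => cutPow k (γ + 1) (ρ x) * inner ℝ (grad (n := n) ρ x) (grad (n := n) u x) +
        deriv (cutPow k (γ + 1)) (ρ x) * u x := by
    filter_upwards [hρ.ae_mdifferentiableAt, hρ.eikonal] with x hx hx1
    rw [hψ, grad_mul (hcd x hx) (hud x),
      grad_comp (hh.differentiable one_ne_zero _).hasDerivAt hx, inner_add_right,
      inner_smul_right, inner_smul_right, inner_smul_right, real_inner_self_eq_norm_sq, hx1]
    ring
  rw [integral_congr_ae e2, integral_add i3 i2] at j3
  refine ⟨i1, i3, ?_⟩
  have hle : (C + γ + 1) * ∫ x, cutPow k γ (ρ x) * u x ∂(riemVolume n M) ≤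
      ∫ x, C / ρ x * ψ x ∂(riemVolume n M) +
        ∫ x, deriv (cutPow k (γ + 1)) (ρ x) * u x ∂(riemVolume n M) := by
    rw [← integral_const_mul, ← integral_add j1 i2]
    refine integral_mono_ae (i1.const_mul _) (j1.add i2) ?_
    filter_upwards [hρ.ae_pos] with x hx
    have h1 := mul_le_mul_of_nonneg_right (le_deriv_cutPow hk γ hx.le) (hu0 x)
    have h2 : C / ρ x * ψ x = C * (cutPow k γ (ρ x) * u x) := by
      rw [hψ]
      simp only
      rw [cutPow_add_one k γ hx]
      field_simp
    rw [h2]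
    linarith
  linarith

/-- The powers `ρ ^ β` with `β > - C - 1` are locally integrable. -/
theorem HardyWeight.locallyIntegrable_rpow (hρ : HardyWeight n ρ C) {β : ℝ}
    (hβ : 0 < C + β + 1) : LocallyIntegrable (fun x => ρ x ^ β) (riemVolume n M) := by
  have : LocallyCompactSpace M := ChartedSpace.locallyCompactSpace (EuclideanSpace ℝ (Fin n)) M
  obtain ⟨N, hN⟩ := exists_nat_ge (-β)
  have hN' : 0 ≤ β + N := by linarith
  clear hN
  -- The induction runs on N with β ≥ -N: for N = 0 the power is continuous, and each step lowers
  -- the exponent by one.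
  induction N generalizing β with
  | zero =>
    simp only [Nat.cast_zero, add_zero] at hN'
    exact (hρ.continuous.rpow_const fun x => Or.inr hN').locallyIntegrable
  | succ N IH =>
    have h1 : LocallyIntegrable (fun x => ρ x ^ (β + 1)) (riemVolume n M) :=
      IH (by linarith) (by push_cast at hN'; linarith)
    rw [locallyIntegrable_iff]
    intro K hK
    obtain ⟨u, hu, huc, hu0, huK⟩ := exists_bump_of_isCompact n hK
    have hA : Integrable (fun x => ρ x ^ (β + 1) * ‖grad (n := n) u x‖) (riemVolume n M) :=
      h1.integrable_smul_right_of_hasCompactSupport (continuous_norm_grad hu)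
        (hasCompactSupport_norm_grad huc)
    set A := ∫ x, ρ x ^ (β + 1) * ‖grad (n := n) u x‖ ∂(riemVolume n M)
    -- The bound by ∫ρ^(β+1) |∇u| / (C + β + 1) is uniform in `k`; Fatou's lemma then passes it to
    -- the limit.
    have hbound (k : ℕ) (hk : 0 < k) :
        ∫⁻ x, ENNReal.ofReal (cutPow k β (ρ x) * u x) ∂(riemVolume n M) ≤
          ENNReal.ofReal (A / (C + β + 1)) := by
      obtain ⟨i1, i2, i3⟩ := hρ.cutoff_inequality hk β hu huc hu0
      rw [← ofReal_integral_eq_lintegral_ofReal i1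
        (Eventually.of_forall fun x => mul_nonneg (cutPow_nonneg _ _ (hρ.nonneg x)) (hu0 x))]
      refine ENNReal.ofReal_le_ofReal ?_
      rw [le_div_iff₀' hβ]
      refine i3.trans ?_
      rw [← integral_neg]
      refine integral_mono_ae i2.neg hA ?_
      filter_upwards [hρ.ae_abs_inner_grad_le u] with x hx
      have h0 := cutPow_nonneg k (β + 1) (hρ.nonneg x)
      calc -(cutPow k (β + 1) (ρ x) * inner ℝ (grad (n := n) ρ x) (grad (n := n) u x))
          = cutPow k (β + 1) (ρ x) * -inner ℝ (grad (n := n) ρ x) (grad (n := n) u x) := by ring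
        _ ≤ cutPow k (β + 1) (ρ x) * ‖grad (n := n) u x‖ := by
            gcongr
            exact (neg_le_abs _).trans hx
        _ ≤ _ := by gcongr; exact cutPow_le _ _ (hρ.nonneg x)
    have hfatou : ∫⁻ x, ENNReal.ofReal (ρ x ^ β * u x) ∂(riemVolume n M) ≤
        ENNReal.ofReal (A / (C + β + 1)) := by
      have hm (k : ℕ) : AEMeasurable (fun x => ENNReal.ofReal (cutPow (k + 1) β (ρ x) * u x))
          (riemVolume n M) :=
        ((((contDiff_cutPow k.succ_pos β).continuous.comp hρ.continuous).mul
          hu.continuous).measurable.ennreal_ofReal).aemeasurable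
      calc _ = ∫⁻ x, liminf (fun k : ℕ => ENNReal.ofReal (cutPow (k + 1) β (ρ x) * u x)) atTop
            ∂(riemVolume n M) := by
            refine lintegral_congr_ae ?_
            filter_upwards [hρ.ae_pos] with x hx
            refine (Tendsto.liminf_eq ?_).symm
            exact (ENNReal.continuous_ofReal.tendsto _).comp
              ((((tendsto_cutPow β hx).comp (tendsto_add_atTop_nat 1))).mul_const _)
        _ ≤ liminf (fun k : ℕ => ∫⁻ x, ENNReal.ofReal (cutPow (k + 1) β (ρ x) * u x)
            ∂(riemVolume n M)) atTop := lintegral_liminf_le' hm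
        _ ≤ liminf (fun k : ℕ => ENNReal.ofReal (A / (C + β + 1))) atTop :=
            liminf_le_liminf (Eventually.of_forall fun k => hbound (k + 1) k.succ_pos)
        _ = _ := liminf_const _
    have hint : Integrable (fun x => ρ x ^ β * u x) (riemVolume n M) := by
      refine ⟨((hρ.continuous.measurable.pow_const β).mul
        hu.continuous.measurable).aestronglyMeasurable, ?_⟩
      rw [hasFiniteIntegral_iff_ofReal
        (Eventually.of_forall fun x => mul_nonneg (Real.rpow_nonneg (hρ.nonneg x) β) (hu0 x))]
      exact hfatou.trans_lt ENNReal.ofReal_lt_top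
    refine (hint.integrableOn (s := K)).congr_fun (fun x hx => ?_) hK.isClosed.measurableSet
    simp only
    rw [huK x hx, mul_one]

/-- The divergence inequality `div (ρ ^ (γ + 1) ∇ρ) ≥ (C + γ + 1) ρ ^ γ`, tested on `C¹`
functions. -/
theorem HardyWeight.integral_rpow_mul_le (hρ : HardyWeight n ρ C) {γ : ℝ}
    (hγ : 0 < C + γ + 1) {u : M → ℝ} (hu : ContMDiff (𝓡 n) 𝓘(ℝ, ℝ) 1 u)
    (huc : HasCompactSupport u) (hu0 : ∀ x, 0 ≤ u x) :
    Integrable (fun x => ρ x ^ γ * u x) (riemVolume n M) ∧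
    Integrable (fun x => ρ x ^ (γ + 1) *
      inner ℝ (grad (n := n) ρ x) (grad (n := n) u x)) (riemVolume n M) ∧
    (C + γ + 1) * ∫ x, ρ x ^ γ * u x ∂(riemVolume n M) ≤
      - ∫ x, ρ x ^ (γ + 1) *
        inner ℝ (grad (n := n) ρ x) (grad (n := n) u x) ∂(riemVolume n M) := by
  have i1 : Integrable (fun x => ρ x ^ γ * u x) (riemVolume n M) :=
    (hρ.locallyIntegrable_rpow hγ).integrable_smul_right_of_hasCompactSupport hu.continuous huc
  -- This function dominates all the cut-off right-hand sides in the passage to the limit.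
  have iA : Integrable (fun x => ρ x ^ (γ + 1) * ‖grad (n := n) u x‖) (riemVolume n M) :=
    (hρ.locallyIntegrable_rpow (by linarith)).integrable_smul_right_of_hasCompactSupport
      (continuous_norm_grad hu) (hasCompactSupport_norm_grad huc)
  have i2 : Integrable (fun x => ρ x ^ (γ + 1) *
      inner ℝ (grad (n := n) ρ x) (grad (n := n) u x)) (riemVolume n M) := by
    refine iA.mono' ((hρ.continuous.measurable.pow_const _).aemeasurable.mul
      (aemeasurable_inner_grad _ _)).aestronglyMeasurable ?_
    filter_upwards [hρ.ae_abs_inner_grad_le u] with x hx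
    have h0 := Real.rpow_nonneg (hρ.nonneg x) (γ + 1)
    rw [norm_mul, Real.norm_of_nonneg h0]
    exact mul_le_mul_of_nonneg_left hx h0
  refine ⟨i1, i2, ?_⟩
  have hk (k : ℕ) := hρ.cutoff_inequality k.succ_pos γ hu huc hu0
  have l1 : Tendsto (fun k : ℕ => ∫ x, cutPow (k + 1) γ (ρ x) * u x ∂(riemVolume n M)) atTop
      (𝓝 (∫ x, ρ x ^ γ * u x ∂(riemVolume n M))) := by
    refine tendsto_integral_of_dominated_convergence _ (fun k => (hk k).1.aestronglyMeasurable) i1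
      (fun k => Eventually.of_forall fun x => ?_) ?_
    · have h0 := cutPow_nonneg (k + 1) γ (hρ.nonneg x)
      rw [norm_mul, Real.norm_of_nonneg h0, Real.norm_of_nonneg (hu0 x)]
      exact mul_le_mul_of_nonneg_right (cutPow_le _ _ (hρ.nonneg x)) (hu0 x)
    · filter_upwards [hρ.ae_pos] with x hx
      exact ((tendsto_cutPow γ hx).comp (tendsto_add_atTop_nat 1)).mul_const _
  have l2 : Tendsto (fun k : ℕ => ∫ x, cutPow (k + 1) (γ + 1) (ρ x) *
      inner ℝ (grad (n := n) ρ x) (grad (n := n) u x) ∂(riemVolume n M)) atTop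
      (𝓝 (∫ x, ρ x ^ (γ + 1) *
        inner ℝ (grad (n := n) ρ x) (grad (n := n) u x) ∂(riemVolume n M))) := by
    refine tendsto_integral_of_dominated_convergence _ (fun k => (hk k).2.1.aestronglyMeasurable)
      iA (fun k => ?_) ?_
    · filter_upwards [hρ.ae_abs_inner_grad_le u] with x hx
      have h0 := cutPow_nonneg (k + 1) (γ + 1) (hρ.nonneg x)
      rw [norm_mul, Real.norm_of_nonneg h0]
      exact mul_le_mul (cutPow_le _ _ (hρ.nonneg x)) hx (abs_nonneg _)
        (Real.rpow_nonneg (hρ.nonneg x) _)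
    · filter_upwards [hρ.ae_pos] with x hx
      exact ((tendsto_cutPow (γ + 1) hx).comp (tendsto_add_atTop_nat 1)).mul_const _
  exact le_of_tendsto_of_tendsto' (l1.const_mul _) l2.neg fun k => (hk k).2.2

end WeightedInequality

/-! ### Hölder and Cauchy–Schwarz estimates on a measure space. -/

section LpEstimates

variable {X : Type*} [MeasurableSpace X] {μ : Measure X}

theorem lintegral_enorm_rpow_eq {f : X → ℝ} (hf : ∀ x, 0 ≤ f x) {q : ℝ} (hq : 0 ≤ q) :
    ∫⁻ x, ‖f x‖ₑ ^ q ∂μ = ∫⁻ x, ENNReal.ofReal (f x ^ q) ∂μ := by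
  refine lintegral_congr fun x => ?_
  rw [Real.enorm_eq_ofReal (hf x), ENNReal.ofReal_rpow_of_nonneg (hf x) hq]

theorem eLpNorm'_eq_ofReal {f : X → ℝ} (hf : ∀ x, 0 ≤ f x) {q : ℝ} (hq : 0 ≤ q)
    (hi : Integrable (fun x => f x ^ q) μ) :
    eLpNorm' f q μ = ENNReal.ofReal ((∫ x, f x ^ q ∂μ) ^ (1 / q)) := by
  have h0 : ∀ x, 0 ≤ f x ^ q := fun x => Real.rpow_nonneg (hf x) q
  rw [eLpNorm', lintegral_enorm_rpow_eq hf hq,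
    ← ofReal_integral_eq_lintegral_ofReal hi (Eventually.of_forall h0),
    ENNReal.ofReal_rpow_of_nonneg (integral_nonneg h0) (by positivity)]

theorem memLp_of_integrable_rpow {f : X → ℝ} (hf : ∀ x, 0 ≤ f x) (hfm : AEStronglyMeasurable f μ)
    {q : ℝ} (hq : 0 < q) (hi : Integrable (fun x => f x ^ q) μ) :
    MemLp f (ENNReal.ofReal q) μ := by
  refine ⟨hfm, ?_⟩
  rw [eLpNorm_eq_eLpNorm' (by simpa using hq) ENNReal.ofReal_ne_top,
    ENNReal.toReal_ofReal hq.le, eLpNorm'_eq_ofReal hf hq.le hi]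
  exact ENNReal.ofReal_lt_top

/-- Absorption of the right-hand side of `κ ∫ s ^ q ≤ c ∫ s ^ (q - 1) W` by Hölder's inequality. -/
theorem eLpNorm'_le_of_integral_rpow_le {s W : X → ℝ} (hs0 : ∀ x, 0 ≤ s x) (hW0 : ∀ x, 0 ≤ W x)
    (hs : AEStronglyMeasurable s μ) (hW : AEStronglyMeasurable W μ) {q κ c : ℝ} (hq : 1 < q)
    (hκ : 0 < κ) (hc : 0 ≤ c) (hsi : Integrable (fun x => s x ^ q) μ)
    (hWi : Integrable (fun x => W x ^ q) μ)
    (h : κ * ∫ x, s x ^ q ∂μ ≤ c * ∫ x, s x ^ (q - 1) * W x ∂μ) :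
    eLpNorm' s q μ ≤ ENNReal.ofReal (c / κ) * eLpNorm' W q μ := by
  have hq0 : 0 < q := by linarith
  have hq1 : 0 < q - 1 := by linarith
  have hconj : (q / (q - 1)).HolderConjugate q := (Real.HolderConjugate.conjExponent hq).symm
  have hpow (x) : (s x ^ (q - 1)) ^ (q / (q - 1)) = s x ^ q := by
    rw [← Real.rpow_mul (hs0 x), mul_div_cancel₀ _ hq1.ne']
  have hm : AEStronglyMeasurable (fun x => s x ^ (q - 1)) μ :=
    (hs.aemeasurable.pow_const _).aestronglyMeasurable
  have hH := integral_mul_le_Lp_mul_Lq_of_nonneg (μ := μ) hconj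
    (Eventually.of_forall fun x => Real.rpow_nonneg (hs0 x) (q - 1)) (Eventually.of_forall hW0)
    (memLp_of_integrable_rpow (fun x => Real.rpow_nonneg (hs0 x) (q - 1)) hm (by positivity)
      (by simp_rw [hpow]; exact hsi))
    (memLp_of_integrable_rpow hW0 hW hq0 hWi)
  simp_rw [hpow] at hH
  have hJ0 : 0 ≤ ∫ x, s x ^ q ∂μ := integral_nonneg fun x => Real.rpow_nonneg (hs0 x) q
  have hT0 : 0 ≤ ∫ x, W x ^ q ∂μ := integral_nonneg fun x => Real.rpow_nonneg (hW0 x) q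
  rw [eLpNorm'_eq_ofReal hs0 hq0.le hsi, eLpNorm'_eq_ofReal hW0 hq0.le hWi,
    ← ENNReal.ofReal_mul (by positivity)]
  refine ENNReal.ofReal_le_ofReal ?_
  set J := ∫ x, s x ^ q ∂μ
  set T := (∫ x, W x ^ q ∂μ) ^ (1 / q)
  have hT : 0 ≤ T := Real.rpow_nonneg hT0 _
  -- If J = ∫s^q is positive, divide by J^(1 - 1/q); it is finite by the integrability assumption.
  rcases hJ0.eq_or_lt with hJ | hJ
  · rw [← hJ, Real.zero_rpow (by positivity)]
    positivity
  · have h1 : κ * J ≤ c * (J ^ (1 / (q / (q - 1))) * T) :=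
      h.trans (mul_le_mul_of_nonneg_left hH hc)
    have h2 : J = J ^ (1 / (q / (q - 1))) * J ^ (1 / q) := by
      rw [← Real.rpow_add hJ]
      have : 1 / (q / (q - 1)) + 1 / q = 1 := by field_simp; ring
      rw [this, Real.rpow_one]
    have h3 : 0 < J ^ (1 / (q / (q - 1))) := Real.rpow_pos_of_pos hJ _
    rw [div_mul_eq_mul_div, le_div_iff₀' hκ]
    refine le_of_mul_le_mul_left ?_ h3
    calc _ = κ * (J ^ (1 / (q / (q - 1))) * J ^ (1 / q)) := by ring
      _ = κ * J := by rw [← h2]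
      _ ≤ _ := h1
      _ = _ := by ring

/-- Minkowski and the bound on s give ‖a‖_q ≤ K ‖W‖_q; as W lives on a set of measure at most v,
Hölder gives ‖W‖_q ≤ v^(1/q - 1/2) ‖W‖_2. -/
theorem sq_eLpNorm'_le {a W s : X → ℝ} (ha0 : ∀ x, 0 ≤ a x)
    (hW0 : ∀ x, 0 ≤ W x) (hs : AEStronglyMeasurable s μ) (hW : AEStronglyMeasurable W μ)
    {q b c K : ℝ} (hq1 : 1 < q) (hq2 : q < 2) (hb : 0 ≤ b) (hc : 0 ≤ c)
    (haW : ∀ᵐ x ∂μ, a x ≤ W x + b * s x)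
    (hsW : eLpNorm' s q μ ≤ ENNReal.ofReal c * eLpNorm' W q μ) (hK : 1 + b * c ≤ K)
    {Ω : Set X} (hΩ : Function.support W ⊆ Ω) {v : ℝ} (hv0 : 0 ≤ v)
    (hv : μ Ω ≤ ENNReal.ofReal v) :
    (∫⁻ x, ENNReal.ofReal (a x ^ q) ∂μ) ^ (2 / q) ≤
      ENNReal.ofReal (K ^ 2 * v ^ (2 / q - 1)) * ∫⁻ x, ENNReal.ofReal (W x ^ 2) ∂μ := by
  have hq0 : 0 < q := by linarith
  have h1 : eLpNorm' a q μ ≤ ENNReal.ofReal K * eLpNorm' W q μ := by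
    calc eLpNorm' a q μ ≤ eLpNorm' (W + b • s) q μ := by
          refine eLpNorm'_mono_ae hq0.le (haW.mono fun x hx => ?_)
          rw [Real.norm_of_nonneg (ha0 x)]
          exact hx.trans (le_abs_self _)
      _ ≤ eLpNorm' W q μ + eLpNorm' (b • s) q μ :=
          eLpNorm'_add_le hW (hs.const_smul b) hq1.le
      _ = eLpNorm' W q μ + ENNReal.ofReal b * eLpNorm' s q μ := by
          rw [eLpNorm'_const_smul b hq0, Real.enorm_eq_ofReal hb]
      _ ≤ eLpNorm' W q μ + ENNReal.ofReal b * (ENNReal.ofReal c * eLpNorm' W q μ) := by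
          gcongr
      _ = ENNReal.ofReal (1 + b * c) * eLpNorm' W q μ := by
          rw [ENNReal.ofReal_add zero_le_one (by positivity), ENNReal.ofReal_one,
            ENNReal.ofReal_mul hb]
          ring
      _ ≤ _ := by gcongr
  have h2 : eLpNorm' W q μ ≤ eLpNorm' W 2 μ * ENNReal.ofReal v ^ (1 / q - 1 / 2) := by
    have e (r : ℝ) (hr : 0 < r) : eLpNorm' W r μ = eLpNorm' W r (μ.restrict Ω) := by
      rw [eLpNorm', eLpNorm', setLIntegral_eq_of_support_subset]
      intro x hx
      refine hΩ fun h => hx ?_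
      simp [h, hr]
    rw [e q hq0, e 2 two_pos]
    refine (eLpNorm'_le_eLpNorm'_mul_rpow_measure_univ hq0 hq2.le hW.restrict).trans ?_
    rw [Measure.restrict_apply_univ]
    have : 0 ≤ 1 / q - 1 / 2 := by
      rw [sub_nonneg]; exact one_div_le_one_div_of_le hq0 hq2.le
    gcongr
  have h3 : (∫⁻ x, ENNReal.ofReal (a x ^ q) ∂μ) ^ (2 / q) = eLpNorm' a q μ ^ (2 : ℝ) := by
    rw [eLpNorm', lintegral_enorm_rpow_eq ha0 hq0.le, ← ENNReal.rpow_mul]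
    congr 1
    ring
  have h4 : eLpNorm' W 2 μ ^ (2 : ℝ) = ∫⁻ x, ENNReal.ofReal (W x ^ 2) ∂μ := by
    rw [eLpNorm', lintegral_enorm_rpow_eq hW0 zero_le_two, ← ENNReal.rpow_mul]
    simp
  have hK0 : 0 ≤ K := le_trans (by positivity) hK
  rw [h3, ← h4]
  calc eLpNorm' a q μ ^ (2 : ℝ)
      ≤ (ENNReal.ofReal K * (eLpNorm' W 2 μ * ENNReal.ofReal v ^ (1 / q - 1 / 2))) ^ (2 : ℝ) := by
        refine ENNReal.rpow_le_rpow (h1.trans ?_) zero_le_two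
        gcongr
    _ = _ := by
        have hnn : 0 ≤ 2 / q - 1 := by rw [sub_nonneg, le_div_iff₀ hq0]; linarith
        rw [ENNReal.mul_rpow_of_nonneg _ _ zero_le_two, ENNReal.mul_rpow_of_nonneg _ _ zero_le_two,
          ← ENNReal.rpow_mul, ENNReal.ofReal_mul (by positivity),
          ENNReal.ofReal_rpow_of_nonneg hK0 zero_le_two,
          ← ENNReal.ofReal_rpow_of_nonneg hv0 hnn]
        have : (1 / q - 1 / 2) * 2 = 2 / q - 1 := by ring
        rw [this, Real.rpow_two]
        ring

/-- The Cauchy–Schwarz inequality with reciprocal weights. -/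
theorem sq_lintegral_sq_le {f w : X → ℝ} (hf : AEMeasurable f μ) (hw : AEMeasurable w μ)
    (hw0 : ∀ᵐ x ∂μ, 0 < w x) (β : ℝ) :
    (∫⁻ x, ENNReal.ofReal (f x ^ 2) ∂μ) ^ 2 ≤
      (∫⁻ x, ENNReal.ofReal (w x ^ (-β) * f x ^ 2) ∂μ) *
        ∫⁻ x, ENNReal.ofReal (w x ^ β * f x ^ 2) ∂μ := by
  have hm (γ : ℝ) : AEMeasurable (fun x => ENNReal.ofReal (w x ^ γ * f x ^ 2) ^ (1 / 2 : ℝ)) μ := by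
    have h1 : AEMeasurable (fun x => w x ^ γ * f x ^ 2) μ := (hw.pow_const γ).mul (hf.pow_const 2)
    exact h1.ennreal_ofReal.pow_const _
  have hH := ENNReal.lintegral_mul_le_Lp_mul_Lq μ Real.HolderConjugate.two_two
    (f := fun x => ENNReal.ofReal (w x ^ (-β) * f x ^ 2) ^ (1 / 2 : ℝ))
    (g := fun x => ENNReal.ofReal (w x ^ β * f x ^ 2) ^ (1 / 2 : ℝ))
    (hm (-β)) (hm β)
  have e1 : ∫⁻ x, ENNReal.ofReal (f x ^ 2) ∂μ =
      ∫⁻ x, ((fun x => ENNReal.ofReal (w x ^ (-β) * f x ^ 2) ^ (1 / 2 : ℝ)) *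
        (fun x => ENNReal.ofReal (w x ^ β * f x ^ 2) ^ (1 / 2 : ℝ))) x ∂μ := by
    refine lintegral_congr_ae ?_
    filter_upwards [hw0] with x hx
    have h1 : (w x ^ (-β) * f x ^ 2) * (w x ^ β * f x ^ 2) = (f x ^ 2) ^ (2 : ℝ) := by
      have : w x ^ (-β) * w x ^ β = 1 := by rw [← Real.rpow_add hx]; simp
      rw [Real.rpow_two]
      linear_combination (f x ^ 2) ^ 2 * this
    have h0 : 0 ≤ w x ^ (-β) * f x ^ 2 := mul_nonneg (Real.rpow_nonneg hx.le _) (sq_nonneg _)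
    rw [Pi.mul_apply, ← ENNReal.mul_rpow_of_nonneg _ _ (by positivity), ← ENNReal.ofReal_mul h0, h1,
      ← ENNReal.ofReal_rpow_of_nonneg (sq_nonneg _) zero_le_two, ← ENNReal.rpow_mul]
    norm_num
  have e2 (h : X → ℝ≥0∞) : ∫⁻ x, (h x ^ (1 / 2 : ℝ)) ^ (2 : ℝ) ∂μ = ∫⁻ x, h x ∂μ := by
    refine lintegral_congr fun x => ?_
    rw [← ENNReal.rpow_mul]; norm_num
  rw [← e1] at hH
  simp only [e2] at hH
  refine (pow_le_pow_left' hH 2).trans_eq ?_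
  rw [mul_pow, ← ENNReal.rpow_two, ← ENNReal.rpow_two, ← ENNReal.rpow_mul, ← ENNReal.rpow_mul,
    one_div_mul_cancel two_ne_zero, ENNReal.rpow_one, ENNReal.rpow_one]

end LpEstimates

/-! ### The Hardy inequality with remainder and its L^q improvement. -/

section Hardy

variable {n : ℕ} {M : Type*} [TopologicalSpace M]
    [ChartedSpace (EuclideanSpace ℝ (Fin n)) M]
    [RiemannianBundle (fun x : M => TangentSpace (𝓡 n) x)]

/-- The vector field `ρ ^ (α / 2 - b) ∇(ρ ^ b φ)`. -/
noncomputable def twistedGrad (ρ φ : M → ℝ) (α b : ℝ) (x : M) : TangentSpace (𝓡 n) x :=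
  ρ x ^ (α / 2) • grad (n := n) φ x + (b * (ρ x ^ (α / 2 - 1) * φ x)) • grad (n := n) ρ x

theorem twistedGrad_eq_zero {ρ φ : M → ℝ} {α b : ℝ} {x : M} (hx : x ∉ tsupport φ) :
    twistedGrad (n := n) ρ φ α b x = 0 := by
  rw [twistedGrad, grad_eq_zero_of_notMem_tsupport hx, image_eq_zero_of_notMem_tsupport hx]
  simp

theorem norm_twistedGrad_sq {ρ φ : M → ℝ} {α b : ℝ} {x : M} (hx : 0 < ρ x)
    (h1 : ‖grad (n := n) ρ x‖ = 1) :
    ‖twistedGrad (n := n) ρ φ α b x‖ ^ 2 = ρ x ^ α * ‖grad (n := n) φ x‖ ^ 2 +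
      b ^ 2 * (ρ x ^ (α - 2) * φ x ^ 2) +
      2 * b * (ρ x ^ (α - 1) * (φ x * inner ℝ (grad (n := n) ρ x) (grad (n := n) φ x))) := by
  have e1 : ρ x ^ α = ρ x ^ (α / 2) * ρ x ^ (α / 2) := by rw [← Real.rpow_add hx]; ring_nf
  have e2 : ρ x ^ (α - 2) = ρ x ^ (α / 2 - 1) * ρ x ^ (α / 2 - 1) := by
    rw [← Real.rpow_add hx]; ring_nf
  have e3 : ρ x ^ (α - 1) = ρ x ^ (α / 2) * ρ x ^ (α / 2 - 1) := by
    rw [← Real.rpow_add hx]; ring_nf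
  rw [twistedGrad, norm_add_sq_real, norm_smul, norm_smul, h1, inner_smul_left, inner_smul_right,
    real_inner_comm, mul_pow, Real.norm_eq_abs, sq_abs, e1, e2, e3, mul_one, Real.norm_eq_abs,
    sq_abs, conj_trivial]
  ring

theorem inner_grad_twistedGrad {ρ φ : M → ℝ} {α b : ℝ} {x : M} (h1 : ‖grad (n := n) ρ x‖ = 1) :
    inner ℝ (grad (n := n) ρ x) (twistedGrad (n := n) ρ φ α b x) =
      ρ x ^ (α / 2) * inner ℝ (grad (n := n) ρ x) (grad (n := n) φ x) +
        b * (ρ x ^ (α / 2 - 1) * φ x) := by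
  rw [twistedGrad, inner_add_right, inner_smul_right, inner_smul_right,
    real_inner_self_eq_norm_sq, h1]
  ring

theorem rpow_mul_norm_grad_le {ρ φ : M → ℝ} {α b : ℝ} {x : M} (hx : 0 < ρ x) (hb : 0 ≤ b)
    (h1 : ‖grad (n := n) ρ x‖ = 1) :
    ρ x ^ (α / 2) * ‖grad (n := n) φ x‖ ≤
      ‖twistedGrad (n := n) ρ φ α b x‖ + b * (ρ x ^ (α / 2 - 1) * |φ x|) := by
  have h2 := norm_sub_le (twistedGrad (n := n) ρ φ α b x)
    ((b * (ρ x ^ (α / 2 - 1) * φ x)) • grad (n := n) ρ x)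
  rw [norm_smul, h1, mul_one, Real.norm_eq_abs, abs_mul, abs_mul, abs_of_nonneg hb,
    abs_of_nonneg (Real.rpow_nonneg hx.le _)] at h2
  refine le_trans (le_of_eq ?_) h2
  rw [twistedGrad, add_sub_cancel_right, norm_smul, Real.norm_of_nonneg (Real.rpow_nonneg hx.le _)]

variable [IsManifold (𝓡 n) ∞ M]
    [IsContMDiffRiemannianBundle (𝓡 n) ∞ (EuclideanSpace ℝ (Fin n))
      (fun x : M => TangentSpace (𝓡 n) x)]
    [MeasurableSpace M] [BorelSpace M] [SecondCountableTopology M] [T2Space M]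
    {ρ φ : M → ℝ} {C α : ℝ}

theorem HardyWeight.integrable_rpow_mul_norm_grad_sq (hρ : HardyWeight n ρ C)
    (hα : 0 < C + α + 1) (hφ : ContMDiff (𝓡 n) 𝓘(ℝ, ℝ) 1 φ) (hφc : HasCompactSupport φ) :
    Integrable (fun x => ρ x ^ α * ‖grad (n := n) φ x‖ ^ 2) (riemVolume n M) := by
  refine (hρ.locallyIntegrable_rpow hα).integrable_smul_right_of_hasCompactSupport
    ((continuous_norm_grad hφ).pow 2) ?_
  simp_rw [sq]
  exact (hasCompactSupport_norm_grad hφc).mul_left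

/-- The weighted Hardy inequality with remainder term `∫ |ρ ^ (α / 2 - b) ∇(ρ ^ b φ)| ^ 2`, where
`b = (C + α - 1) / 2`. -/
theorem HardyWeight.integral_norm_twistedGrad_sq_le (hρ : HardyWeight n ρ C)
    (hα : 0 < C + α - 1) (hφ : ContMDiff (𝓡 n) 𝓘(ℝ, ℝ) 1 φ) (hφc : HasCompactSupport φ) :
    Integrable (fun x => ρ x ^ (α - 2) * φ x ^ 2) (riemVolume n M) ∧
    Integrable (fun x => ‖twistedGrad (n := n) ρ φ α ((C + α - 1) / 2) x‖ ^ 2) (riemVolume n M) ∧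
    ∫ x, ‖twistedGrad (n := n) ρ φ α ((C + α - 1) / 2) x‖ ^ 2 ∂(riemVolume n M) +
        ((C + α - 1) / 2) ^ 2 * ∫ x, ρ x ^ (α - 2) * φ x ^ 2 ∂(riemVolume n M) ≤
      ∫ x, ρ x ^ α * ‖grad (n := n) φ x‖ ^ 2 ∂(riemVolume n M) := by
  set b := (C + α - 1) / 2 with hb
  have hA := hρ.integrable_rpow_mul_norm_grad_sq (α := α) (by linarith) hφ hφc
  have hsq : ContDiff ℝ 1 fun t : ℝ => t ^ 2 := by fun_prop
  have hu : ContMDiff (𝓡 n) 𝓘(ℝ, ℝ) 1 fun x => φ x ^ 2 := hsq.contMDiff.comp hφ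
  have huc : HasCompactSupport fun x => φ x ^ 2 :=
    hφc.comp_left (g := fun t : ℝ => t ^ 2) (by simp)
  obtain ⟨i1, i2, i3⟩ := hρ.integral_rpow_mul_le (γ := α - 2) (by linarith) hu huc
    fun x => sq_nonneg _
  have hγ : α - 2 + 1 = α - 1 := by ring
  rw [hγ] at i2 i3
  have hg (x : M) : grad (n := n) (fun x => φ x ^ 2) x = (2 * φ x) • grad (n := n) φ x := by
    refine grad_comp (h := fun t : ℝ => t ^ 2) ?_ (hφ.mdifferentiable one_ne_zero x)
    simpa using hasDerivAt_pow 2 (φ x)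
  have e : (fun x => ‖twistedGrad (n := n) ρ φ α b x‖ ^ 2) =ᵐ[riemVolume n M] fun x =>
      ρ x ^ α * ‖grad (n := n) φ x‖ ^ 2 + b ^ 2 * (ρ x ^ (α - 2) * φ x ^ 2) +
        b * (ρ x ^ (α - 1) * inner ℝ (grad (n := n) ρ x) (grad (n := n) (fun x => φ x ^ 2) x)) := by
    filter_upwards [hρ.ae_pos, hρ.eikonal] with x hx h1
    rw [norm_twistedGrad_sq hx h1, hg, inner_smul_right]
    ring
  refine ⟨i1, ((hA.add (i1.const_mul (b ^ 2))).add (i2.const_mul b)).congr e.symm, ?_⟩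
  have key := integral_add (hA.add (i1.const_mul (b ^ 2))) (i2.const_mul b)
  simp only [Pi.add_apply] at key
  rw [integral_congr_ae e, key, integral_add hA (i1.const_mul _), integral_const_mul,
    integral_const_mul]
  have hb0 : 0 < b := by rw [hb]; linarith
  -- With this identity the cross term contributes at most -2b² ∫ρ^(α-2) φ², against +b² from the
  -- square.
  have hCb : C + (α - 2) + 1 = 2 * b := by rw [hb]; ring
  rw [hCb] at i3
  have := mul_le_mul_of_nonneg_left i3 hb0.le
  linarith

/-- Use t^q ≤ 1 + t² on the support of φ, which has finite volume; outside it the field vanishes. -/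
theorem integrable_norm_twistedGrad_rpow {b q : ℝ} (hq0 : 0 < q) (hq2 : q < 2)
    (hφc : HasCompactSupport φ)
    (hi : Integrable (fun x => ‖twistedGrad (n := n) ρ φ α b x‖ ^ 2) (riemVolume n M)) :
    AEStronglyMeasurable (fun x => ‖twistedGrad (n := n) ρ φ α b x‖) (riemVolume n M) ∧
    Integrable (fun x => ‖twistedGrad (n := n) ρ φ α b x‖ ^ q) (riemVolume n M) := by
  have hm : AEMeasurable (fun x => ‖twistedGrad (n := n) ρ φ α b x‖) (riemVolume n M) := by
    have := hi.aestronglyMeasurable.aemeasurable.sqrt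
    simpa only [Real.sqrt_sq (norm_nonneg _)] using this
  refine ⟨hm.aestronglyMeasurable, ?_⟩
  have hS : Integrable ((tsupport φ).indicator fun _ => (1 : ℝ)) (riemVolume n M) :=
    (integrable_indicator_iff (isClosed_tsupport φ).measurableSet).2
      (integrableOn_const hφc.isCompact.measure_lt_top.ne)
  refine (hS.add hi).mono' (hm.pow_const q).aestronglyMeasurable (Eventually.of_forall fun x => ?_)
  rw [Real.norm_of_nonneg (Real.rpow_nonneg (norm_nonneg _) q), Pi.add_apply]
  by_cases hx : x ∈ tsupport φ
  · rw [indicator_of_mem hx]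
    rcases le_total ‖twistedGrad (n := n) ρ φ α b x‖ 1 with h | h
    · have := Real.rpow_le_one (norm_nonneg _) h hq0.le
      linarith [sq_nonneg ‖twistedGrad (n := n) ρ φ α b x‖]
    · have := Real.rpow_le_rpow_of_exponent_le h hq2.le
      rw [Real.rpow_two] at this
      linarith
  · rw [indicator_of_notMem hx, twistedGrad_eq_zero hx]
    simp [hq0.ne']

/-- The weighted `L^q` Hardy inequality for `ρ ^ b φ`. -/
theorem HardyWeight.integral_rpow_le_integral_twistedGrad (hρ : HardyWeight n ρ C)
    (hC : 0 < C) (hα : 0 < C + α - 1) {q : ℝ} (hq1 : 1 < q) (hq2 : q < 2)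
    (hφ : ContMDiff (𝓡 n) 𝓘(ℝ, ℝ) 1 φ) (hφc : HasCompactSupport φ) :
    Integrable (fun x => (ρ x ^ (α / 2 - 1) * |φ x|) ^ q) (riemVolume n M) ∧
    (C + 1) * (1 - q / 2) * ∫ x, (ρ x ^ (α / 2 - 1) * |φ x|) ^ q ∂(riemVolume n M) ≤
      q * ∫ x, (ρ x ^ (α / 2 - 1) * |φ x|) ^ (q - 1) *
        ‖twistedGrad (n := n) ρ φ α ((C + α - 1) / 2) x‖ ∂(riemVolume n M) := by
  set b := (C + α - 1) / 2 with hb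
  have hq0 : 0 < q := by linarith
  obtain ⟨hWm, hWi⟩ := integrable_norm_twistedGrad_rpow (q := q) hq0 hq2 hφc
    (hρ.integral_norm_twistedGrad_sq_le hα hφ hφc).2.1
  rw [← hb] at hWm hWi
  set m := (α / 2 - 1) * q with hm
  -- If α < 2, then m > α - 2 because q < 2, and C + α - 1 > 0 applies.
  have hCm : 0 < C + m + 1 := by
    rw [hm]
    rcases le_or_gt 0 (α / 2 - 1) with h | h
    · positivity
    · nlinarith
  have hr : ContDiff ℝ 1 fun t : ℝ => |t| ^ q := contDiff_norm_rpow (E := ℝ) hq1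
  have hu : ContMDiff (𝓡 n) 𝓘(ℝ, ℝ) 1 fun x => |φ x| ^ q := hr.contMDiff.comp hφ
  have huc : HasCompactSupport fun x => |φ x| ^ q :=
    hφc.comp_left (g := fun t : ℝ => |t| ^ q) (by simp [hq0.ne'])
  obtain ⟨i1, i2, i3⟩ := hρ.integral_rpow_mul_le hCm hu huc fun x => by positivity
  have hg (x : M) : grad (n := n) (fun x => |φ x| ^ q) x =
      (q * |φ x| ^ (q - 2) * φ x) • grad (n := n) φ x :=
    grad_comp (h := fun t : ℝ => |t| ^ q) (hasDerivAt_abs_rpow _ hq1)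
      (hφ.mdifferentiable one_ne_zero x)
  set s : M → ℝ := fun x => ρ x ^ (α / 2 - 1) * |φ x| with hs
  have hs0 (x) : 0 ≤ s x := mul_nonneg (Real.rpow_nonneg (hρ.nonneg x) _) (abs_nonneg _)
  have hsq (x) : s x ^ q = ρ x ^ m * |φ x| ^ q := by
    rw [hs]
    simp only
    rw [Real.mul_rpow (Real.rpow_nonneg (hρ.nonneg x) _) (abs_nonneg _),
      ← Real.rpow_mul (hρ.nonneg x)]
  have j1 : Integrable (fun x => s x ^ q) (riemVolume n M) := by simp_rw [hsq]; exact i1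
  have hsm : Measurable s :=
    (hρ.continuous.measurable.pow_const _).mul (continuous_abs.measurable.comp hφ.continuous.measurable)
  -- Dominated by s^q + W^q, comparing s and W pointwise.
  have j2 : Integrable (fun x => s x ^ (q - 1) * ‖twistedGrad (n := n) ρ φ α b x‖)
      (riemVolume n M) := by
    refine (j1.add hWi).mono' ((hsm.pow_const _).aestronglyMeasurable.mul hWm)
      (Eventually.of_forall fun x => ?_)
    set W := ‖twistedGrad (n := n) ρ φ α b x‖
    have hW0 : 0 ≤ W := norm_nonneg _
    have hq' : 0 ≤ q - 1 := by linarith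
    have e (t : ℝ) (ht : 0 ≤ t) : t ^ (q - 1) * t = t ^ q := by
      rw [← Real.rpow_add_one' ht (by linarith), sub_add_cancel]
    rw [Real.norm_of_nonneg (mul_nonneg (Real.rpow_nonneg (hs0 x) _) hW0), Pi.add_apply]
    have p1 := Real.rpow_nonneg (hs0 x) q
    have p2 := Real.rpow_nonneg hW0 q
    rcases le_total W (s x) with h | h
    · have := mul_le_mul_of_nonneg_left h (Real.rpow_nonneg (hs0 x) (q - 1))
      rw [e _ (hs0 x)] at this
      linarith
    · have := mul_le_mul_of_nonneg_right (Real.rpow_le_rpow (hs0 x) h hq') hW0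
      rw [e _ hW0] at this
      linarith
  refine ⟨j1, ?_⟩
  have hle : (C + m + 1) * ∫ x, s x ^ q ∂(riemVolume n M) ≤
      q * b * ∫ x, s x ^ q ∂(riemVolume n M) + q * ∫ x, s x ^ (q - 1) *
        ‖twistedGrad (n := n) ρ φ α b x‖ ∂(riemVolume n M) := by
    rw [← integral_const_mul, ← integral_const_mul, ← integral_const_mul,
      ← integral_add (j1.const_mul _) (j2.const_mul _), integral_const_mul]
    simp_rw [hsq] at i3 ⊢
    refine i3.trans ?_
    rw [← integral_neg]
    have j1' := j1
    simp_rw [hsq] at j1'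
    refine integral_mono_ae i2.neg ((j1'.const_mul _).add (j2.const_mul _)) ?_
    filter_upwards [hρ.ae_pos, hρ.eikonal] with x hx h1
    have ht := abs_real_inner_le_norm (grad (n := n) ρ x) (twistedGrad (n := n) ρ φ α b x)
    rw [h1, one_mul, inner_grad_twistedGrad h1] at ht
    rw [hg, inner_smul_right]
    set y := inner ℝ (grad (n := n) ρ x) (grad (n := n) φ x)
    set W := ‖twistedGrad (n := n) ρ φ α b x‖
    set R := |φ x| ^ (q - 2) * φ x with hR
    have hRa : |R| = |φ x| ^ (q - 1) := by
      rw [hR, abs_mul, abs_of_nonneg (Real.rpow_nonneg (abs_nonneg _) _),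
        ← Real.rpow_add_one' (abs_nonneg _) (by linarith)]
      ring_nf
    have hRφ : R * φ x = |φ x| ^ q := by
      rw [hR, mul_assoc, ← sq, ← sq_abs, ← Real.rpow_two,
        ← Real.rpow_add' (abs_nonneg _) (by linarith)]
      ring_nf
    set P := ρ x ^ ((α / 2 - 1) * (q - 1)) with hP
    have hP0 : 0 ≤ P := Real.rpow_nonneg hx.le _
    have hPs : s x ^ (q - 1) = P * |R| := by
      rw [hs, hRa, hP]
      simp only
      rw [Real.mul_rpow (Real.rpow_nonneg hx.le _) (abs_nonneg _), ← Real.rpow_mul hx.le]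
    have e1 : ρ x ^ (m + 1) = P * ρ x ^ (α / 2) := by
      rw [hP, ← Real.rpow_add hx]; congr 1; rw [hm]; ring
    have e2 : ρ x ^ m = P * ρ x ^ (α / 2 - 1) := by
      rw [hP, ← Real.rpow_add hx]; congr 1; rw [hm]; ring
    -- Adding and subtracting the ∇ρ part of the twisted field completes ρ^(α/2) ∇φ to that field,
    -- at the price of the term q b s^q.
    have e3 : -(ρ x ^ (m + 1) * (q * |φ x| ^ (q - 2) * φ x * y)) =
        q * b * (ρ x ^ m * |φ x| ^ q) - q * (P * (R * (ρ x ^ (α / 2) * y +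
          b * (ρ x ^ (α / 2 - 1) * φ x)))) := by
      rw [e1, e2, ← hRφ, hR]; ring
    have e4 : -(R * (ρ x ^ (α / 2) * y + b * (ρ x ^ (α / 2 - 1) * φ x))) ≤ |R| * W := by
      refine (neg_le_abs _).trans ?_
      rw [abs_mul]
      exact mul_le_mul_of_nonneg_left ht (abs_nonneg _)
    have e5 := mul_le_mul_of_nonneg_left (mul_le_mul_of_nonneg_left e4 hP0) hq0.le
    rw [e3, hPs]
    linarith
  -- After absorbing q b ∫s^q, the terms in α cancel.
  have hκ : (C + 1) * (1 - q / 2) = C + m + 1 - q * b := by rw [hm, hb]; ring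
  rw [hκ]
  linarith

/-- The remainder ∫|W|² of the Hardy inequality is bounded below by the squared L^q norm of ρ^(α/2)
|∇φ|. The constant involves only q, α and the volume bound v. -/
theorem HardyWeight.improved_hardy (hρ : HardyWeight n ρ C)
    (hC : 0 < C) (hα : 0 < C + α - 1) {q : ℝ} (hq1 : 1 < q) (hq2 : q < 2)
    (hφ : ContMDiff (𝓡 n) 𝓘(ℝ, ℝ) 1 φ) (hφc : HasCompactSupport φ) {Ω : Set M}
    (hφΩ : tsupport φ ⊆ Ω) {v : ℝ} (hv0 : 0 < v)
    (hv : riemVolume n M Ω ≤ ENNReal.ofReal v) :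
    ENNReal.ofReal (((1 + q * (1 + |α - 2|) / (2 - q)) ^ 2 * v ^ (2 / q - 1))⁻¹) *
        integralM n (fun x => ρ x ^ (α * q / 2) * ‖grad (n := n) φ x‖ ^ q) ^ (2 / q) +
      ENNReal.ofReal (((C + α - 1) / 2) ^ 2) * integralM n (fun x => ρ x ^ (α - 2) * φ x ^ 2) ≤
    integralM n (fun x => ρ x ^ α * ‖grad (n := n) φ x‖ ^ 2) := by
  set b := (C + α - 1) / 2 with hb
  set K := 1 + q * (1 + |α - 2|) / (2 - q) with hK
  have hq0 : 0 < q := by linarith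
  have h2q : 0 < 2 - q := by linarith
  have hb0 : 0 < b := by rw [hb]; linarith
  have hK0 : 0 < K := by positivity
  set W : M → ℝ := fun x => ‖twistedGrad (n := n) ρ φ α b x‖ with hW
  set s : M → ℝ := fun x => ρ x ^ (α / 2 - 1) * |φ x| with hs
  have hs0 (x) : 0 ≤ s x := mul_nonneg (Real.rpow_nonneg (hρ.nonneg x) _) (abs_nonneg _)
  have hsm : Measurable s :=
    (hρ.continuous.measurable.pow_const _).mul (continuous_abs.measurable.comp hφ.continuous.measurable)
  obtain ⟨hD, hW2, hHardy⟩ := hρ.integral_norm_twistedGrad_sq_le hα hφ hφc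
  obtain ⟨hWm, hWq⟩ := integrable_norm_twistedGrad_rpow hq0 hq2 hφc hW2
  obtain ⟨hsq, hsW⟩ := hρ.integral_rpow_le_integral_twistedGrad hC hα hq1 hq2 hφ hφc
  have hA := hρ.integrable_rpow_mul_norm_grad_sq (α := α) (by linarith) hφ hφc
  have hκ : 0 < (C + 1) * (1 - q / 2) := mul_pos (by linarith) (by linarith)
  have hnorm := eLpNorm'_le_of_integral_rpow_le hs0 (fun x => norm_nonneg _)
    hsm.aestronglyMeasurable hWm hq1 hκ hq0.le hsq hWq hsW
  have hKc : 1 + b * (q / ((C + 1) * (1 - q / 2))) ≤ K := by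
    rw [hK]
    -- Here 2b = (C + 1) + (α - 2) and C + 1 ≥ 1; the factor C + 1 then cancels against the L^q
    -- Hardy constant, which removes C from the bound.
    have h1 : b ≤ (C + 1) * (1 + |α - 2|) / 2 := by
      rw [hb]
      nlinarith [le_abs_self (α - 2), abs_nonneg (α - 2)]
    have h2 : b * (q / ((C + 1) * (1 - q / 2))) ≤
        (C + 1) * (1 + |α - 2|) / 2 * (q / ((C + 1) * (1 - q / 2))) := by gcongr
    have hC1 : 0 < C + 1 := by linarith
    have h3 : (C + 1) * (1 + |α - 2|) / 2 * (q / ((C + 1) * (1 - q / 2))) =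
        q * (1 + |α - 2|) / (2 - q) := by
      have : (1 : ℝ) - q / 2 = (2 - q) / 2 := by ring
      rw [this]
      field_simp
    linarith
  have hfinal := sq_eLpNorm'_le (μ := riemVolume n M) (a := fun x => ρ x ^ (α / 2) *
      ‖grad (n := n) φ x‖) (fun x => mul_nonneg (Real.rpow_nonneg (hρ.nonneg x) _) (norm_nonneg _))
    (fun x => norm_nonneg _) hsm.aestronglyMeasurable hWm hq1 hq2 hb0.le (by positivity)
    (by
      filter_upwards [hρ.ae_pos, hρ.eikonal] with x hx h1
      exact rpow_mul_norm_grad_le hx hb0.le h1)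
    hnorm hKc (Ω := Ω) (fun x hx => hφΩ (by
      by_contra h
      exact hx (by simp only [← hb, twistedGrad_eq_zero h, norm_zero]))) hv0.le hv
  have hB : ∫⁻ x, ENNReal.ofReal ((ρ x ^ (α / 2) * ‖grad (n := n) φ x‖) ^ q) ∂(riemVolume n M) =
      integralM n (fun x => ρ x ^ (α * q / 2) * ‖grad (n := n) φ x‖ ^ q) := by
    refine lintegral_congr fun x => ?_
    rw [Real.mul_rpow (Real.rpow_nonneg (hρ.nonneg x) _) (norm_nonneg _),
      ← Real.rpow_mul (hρ.nonneg x)]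
    congr 3
    ring
  rw [hB] at hfinal
  have hcst : 0 < K ^ 2 * v ^ (2 / q - 1) := mul_pos (by positivity) (Real.rpow_pos_of_pos hv0 _)
  have h1 : ENNReal.ofReal ((K ^ 2 * v ^ (2 / q - 1))⁻¹) *
      integralM n (fun x => ρ x ^ (α * q / 2) * ‖grad (n := n) φ x‖ ^ q) ^ (2 / q) ≤
      ∫⁻ x, ENNReal.ofReal (W x ^ 2) ∂(riemVolume n M) := by
    refine (mul_le_mul_right hfinal _).trans_eq ?_
    rw [← mul_assoc, ← ENNReal.ofReal_mul (by positivity), inv_mul_cancel₀ hcst.ne',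
      ENNReal.ofReal_one, one_mul]
  refine (add_le_add_left h1 _).trans ?_
  have hW2' : 0 ≤ ∫ x, W x ^ 2 ∂(riemVolume n M) := integral_nonneg fun x => sq_nonneg _
  have hD0 : ∀ x, 0 ≤ ρ x ^ (α - 2) * φ x ^ 2 := fun x =>
    mul_nonneg (Real.rpow_nonneg (hρ.nonneg x) _) (sq_nonneg _)
  rw [integralM, integralM, ← ofReal_integral_eq_lintegral_ofReal hW2
      (Eventually.of_forall fun x => sq_nonneg _),
    ← ofReal_integral_eq_lintegral_ofReal hD (Eventually.of_forall hD0),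
    ← ofReal_integral_eq_lintegral_ofReal hA (Eventually.of_forall fun x =>
      mul_nonneg (Real.rpow_nonneg (hρ.nonneg x) _) (sq_nonneg _)),
    ← ENNReal.ofReal_mul (sq_nonneg _),
    ← ENNReal.ofReal_add hW2' (mul_nonneg (sq_nonneg _) (integral_nonneg hD0))]
  exact ENNReal.ofReal_le_ofReal hHardy

end Hardy

end RiemHardy

/-! ### The uncertainty inequality. -/

theorem corollary2p6
    {n : ℕ} (hn : 1 < n)
    {M : Type*} [MetricSpace M] [SecondCountableTopology M]
    [ChartedSpace (EuclideanSpace ℝ (Fin n)) M] [IsManifold (𝓡 n) ∞ M]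
    [RiemannianBundle (fun x : M => TangentSpace (𝓡 n) x)]
    [IsContMDiffRiemannianBundle (𝓡 n) ∞ (EuclideanSpace ℝ (Fin n))
      (fun x : M => TangentSpace (𝓡 n) x)]
    [IsRiemannianManifold (𝓡 n) M]
    [CompleteSpace M] [NoncompactSpace M]
    [MeasurableSpace M] [BorelSpace M]
    (Ω : Set M) (hΩo : IsOpen Ω) (hΩb : Bornology.IsBounded Ω)
    (q : ℝ) (hq1 : 1 < q) (hq2 : q < 2) (α : ℝ) :
    ∃ C₁ : ℝ, 0 < C₁ ∧
      ∀ (C : ℝ) (ρ : M → ℝ), 0 < C → 0 < C + α - 1 →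
        (∀ x, 0 ≤ ρ x) → LocallyLipschitz ρ →
        (∀ᵐ x ∂(riemVolume n M), ‖grad (n := n) ρ x‖ = 1) →
        DistribLaplacianGe n ρ C →
        ∀ φ : M → ℝ, ContMDiff (𝓡 n) 𝓘(ℝ, ℝ) ∞ φ → HasCompactSupport φ → tsupport φ ⊆ Ω →
          integralM n (fun x => ρ x ^ α * ‖grad (n := n) φ x‖ ^ 2) < ⊤ ∧
          ENNReal.ofReal C₁ *
              integralM n
                (fun x => ρ x ^ (α * q / 2) * ‖grad (n := n) φ x‖ ^ q) ^ (2 / q) ≤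
            integralM n (fun x => ρ x ^ α * ‖grad (n := n) φ x‖ ^ 2) ∧
          ENNReal.ofReal (((C + α - 1) / 2) ^ 2) *
              integralM n (fun x => φ x ^ 2) ^ 2 ≤
            integralM n (fun x => ρ x ^ (2 - α) * φ x ^ 2) *
              (integralM n (fun x => ρ x ^ α * ‖grad (n := n) φ x‖ ^ 2) -
                ENNReal.ofReal C₁ *
                  integralM n
                    (fun x => ρ x ^ (α * q / 2) * ‖grad (n := n) φ x‖ ^ q) ^ (2 / q)) := by
  have : ProperSpace M := properSpace_of_isRiemannianManifold n
  have hΩ : riemVolume n M Ω < ⊤ :=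
    (measure_mono subset_closure).trans_lt hΩb.isCompact_closure.measure_lt_top
  -- Adding 1 keeps the constant well defined and positive even when Ω is empty.
  have hv0 : 0 < (riemVolume n M Ω).toReal + 1 := by positivity
  have hv : riemVolume n M Ω ≤ ENNReal.ofReal ((riemVolume n M Ω).toReal + 1) := by
    rw [ENNReal.le_ofReal_iff_toReal_le hΩ.ne hv0.le]
    linarith
  have h2q : 0 < 2 - q := by linarith
  refine ⟨_, inv_pos.2 (mul_pos (pow_pos (show 0 < 1 + q * (1 + |α - 2|) / (2 - q) by positivity) 2)
    (Real.rpow_pos_of_pos hv0 (2 / q - 1))), ?_⟩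
  intro C ρ hC hCα hρ0 hρL hρ1 hΔ φ hφ hφc hφΩ
  have hρ : HardyWeight n ρ C :=
    ⟨hρ0, hρL.continuous, fun p u hu => exists_lipschitzOnWith_comp_chart_symm hρL hu, hρ1, hΔ⟩
  have hφ1 : ContMDiff (𝓡 n) 𝓘(ℝ, ℝ) 1 φ := hφ.of_le (by norm_cast)
  have hA : integralM n (fun x => ρ x ^ α * ‖grad (n := n) φ x‖ ^ 2) < ⊤ :=
    (hρ.integrable_rpow_mul_norm_grad_sq (by linarith) hφ1 hφc).lintegral_lt_top
  have hmain := hρ.improved_hardy hC hCα hq1 hq2 hφ1 hφc hφΩ hv0 hv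
  have hle := le_self_add.trans hmain
  refine ⟨hA, hle, ?_⟩
  -- The exponent α - 2 pairs the weight of the Hardy term with the reciprocal weight of the first
  -- factor.
  have hCS := sq_lintegral_sq_le (μ := riemVolume n M) hφ.continuous.aemeasurable
    hρ.continuous.aemeasurable hρ.ae_pos (α - 2)
  rw [neg_sub] at hCS
  calc _ ≤ ENNReal.ofReal (((C + α - 1) / 2) ^ 2) *
        (integralM n (fun x => ρ x ^ (2 - α) * φ x ^ 2) *
          integralM n (fun x => ρ x ^ (α - 2) * φ x ^ 2)) := mul_le_mul_right hCS _
    _ = integralM n (fun x => ρ x ^ (2 - α) * φ x ^ 2) *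
        (ENNReal.ofReal (((C + α - 1) / 2) ^ 2) *
          integralM n (fun x => ρ x ^ (α - 2) * φ x ^ 2)) := by ring
    _ ≤ _ := by
      refine mul_le_mul_right ?_ _
      -- Moving the L^q term across the truncated subtraction is legitimate because that term is
      -- finite.
      exact ENNReal.le_sub_of_add_le_left (hle.trans_lt hA).ne hmain
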